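/- **Setting.** Let $(\mathcal X,\mathcal A)$ be a measurable space and $\mathcal H\subseteq[0,1]^{\mathcal X}$ a class of measurable functions; the loss is $\ell(y,y')=|y-y'|$. For $\gamma\in[0,1]$, a sample $(x_1,\dots,x_n)\in\mathcal X^n$ is *$\gamma$-graph shattered* by $\mathcal H$ if there is $f:[n]\to[0,1]$ such that for every $b\in\{0,1\}^n$ some $h_b\in\mathcal H$ satisfies $h_b(x_i)=f(i)$ whenever $b_i=0$ and $|h_b(x_i)-f(i)|>\gamma$ whenever $b_i=1$. The *$\gamma$-graph dimension* $\mathbb D^{\mathrm G}_\gamma(\mathcal H)\in\mathbb N\cup\{\infty\}$ is the supremum of the sizes of $\gamma$-graph shattered samples. A learner $A$ maps every finite labeled sample in $\bigcup_n(\mathcal X\times[0,1])^n$ to a function $\mathcal X\to[0,1]$. It is an *ERM* for $\mathcal H$ if on every sample that is realizable by $\mathcal H$ it returns a member of $\mathcal H$ with zero error on the sample. For $S=(x_1,\dots,x_m)$ and a target $h^\star\in\mathcal H$ write $A(S)$ for the output of $A$ on $((x_i,h^\star(x_i)))_{i\le m}$. Let $\mathcal M_A(\mathcal H;\varepsilon,\delta)\in\mathbb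 N\cup\{\infty\}$ be the least $M$ such that for all $m\ge M$, all probability measures $\mathcal D$ on $\mathcal X$ and all $h^\star\in\mathcal H$, with probability at least $1-\delta$ over $S\sim\mathcal D^m$ one has $\mathbf E_{x\sim\mathcal D}[\ell(A(S)(x),h^\star(x))]\le\varepsilon$; let $\mathcal M_A(\mathcal H;\varepsilon,\delta,\gamma)$ be defined in the same way with $\Pr_{x\sim\mathcal D}[\ell(A(S)(x),h^\star(x))>\gamma]\le\varepsilon$ instead (cut-off loss). Put $\mathcal M_{\mathrm{ERM}}(\mathcal H;\cdot)=\sup_{A\ \mathrm{ERM}}\mathcal M_A(\mathcal H;\cdot)$. The learner $A$ is a *PAC learner* for $\mathcal H$ if for all $\varepsilon,\delta\in(0,1)$ there is $n$ such that for all $\mathcal D$ and $h^\star\in\mathcal H$, with probability at least $1-\delta$ over $S\sim\mathcal D^n$, $\mathbf E_{x\sim\mathcal D}[\ell(A(S)(x),h^\star(x))]\le\varepsilon$. (The event that the required bound fails has outer probability at most $\delta$.) Call $\mathcal H$ *admissible at scale $\gamma$* if for all $\mathcal D$, all $h^\star\in\mathcal H$ and all $n,k\in\mathbb N$ the set of $(r,s)\in\mathcal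 X^n\times\mathcal X^n$ for which some $h\in\mathcal H$ has $h(r_i)=h^\star(r_i)$ for all $i$ and $|h(s_i)-h^\star(s_i)|>\gamma$ for at least $k$ indices $i$ is measurable up to a $\mathcal D^n\otimes\mathcal D^n$-null set. (This mild regularity condition holds, for example, for countable classes and for image admissible Suslin classes.) Call $\mathcal H$ *nondegenerate at scale $\gamma$* if there are $h,g\in\mathcal H$ and $x,y\in\mathcal X$ with $h(x)=g(x)$ and $|h(y)-g(y)|>\gamma$. (This is automatic if $\mathbb D^{\mathrm G}_\gamma(\mathcal H)\ge2$; if it fails, then $\mathcal M_{\mathrm{ERM}}(\mathcal H;\varepsilon,\delta,\gamma)\le1$.) **Theorem.** 1. For every $\eta\in(0,1)$ there are constants $c,C>0$, depending only on $\eta$, such that for all $\mathcal X$, $\mathcal H$ as above, all $\gamma\in(0,1)$ and all $\varepsilon,\delta\in(0,\eta]$: if $\mathcal H$ is nondegenerate at scale $\gamma$, then $$c\,\frac{\mathbb D^{\mathrm G}_\gamma(\mathcal H)+\log(1/\delta)}{\varepsilon}\ \le\ \mathcal M_{\mathrm{ERM}}(\mathcal H;\varepsilon,\delta,\gamma),$$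 and if $\mathcal H$ is admissible at scale $\gamma$, then $$\mathcal M_{\mathrm{ERM}}(\mathcal H;\varepsilon,\delta,\gamma)\ \le\ C\,\frac{\mathbb D^{\mathrm G}_\gamma(\mathcal H)\log(1/\varepsilon)+\log(1/\delta)}{\varepsilon}.$$ Under the same respective conditions, the same lower bound holds for $\mathcal M_{\mathrm{ERM}}(\mathcal H;\gamma\varepsilon,\delta)$ and the same upper bound for $\mathcal M_{\mathrm{ERM}}(\mathcal H;\gamma+\varepsilon,\delta)$, the sample complexities for the expected absolute loss. 2. There is an absolute constant $K>0$ such that, if $\mathcal H$ is admissible at every scale $\gamma\in[0,1]$, then for every ERM $A$ for $\mathcal H$, every $n\ge1$, $\delta\in(0,1)$, every probability measure $\mathcal D$ on $\mathcal X$ and every $h^\star\in\mathcal H$, with probability at least $1-\delta$ over $S\sim\mathcal D^n$, $$\mathbf E_{x\sim\mathcal D}[\ell(A(S)(x),h^\star(x))]\ \le\ \inf_{\gamma\in[0,1]}\left(\gamma+K\,\frac{\mathbb D^{\mathrm G}_\gamma(\mathcal H)\log(n+1)+\log(1/\delta)}{n}\right).$$ 3. If $\mathcal H$ is admissible at every scale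 $\gamma\in(0,1)$, the following are equivalent: (a) every ERM for $\mathcal H$ is a PAC learner for $\mathcal H$; (b) $\mathcal M_{\mathrm{ERM}}(\mathcal H;\varepsilon,\delta)<\infty$ for all $\varepsilon,\delta\in(0,1)$; (c) $\mathbb D^{\mathrm G}_\gamma(\mathcal H)<\infty$ for all $\gamma\in(0,1)$. -/

import Mathlib

open MeasureTheory Set
open scoped ENNReal

universe u

/-- The sample `S ∈ X^n` is `γ`-graph shattered by `H` (with respect to the absolute loss). -/
def GraphShattered {X : Type u} (H : Set (X → unitInterval)) (γ : ℝ) {n : ℕ}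
    (S : Fin n → X) : Prop :=
  ∃ f : Fin n → unitInterval, ∀ b : Fin n → Bool, ∃ h ∈ H, ∀ i : Fin n,
    (b i = false → h (S i) = f i) ∧ (b i = true → γ < |(h (S i) : ℝ) - (f i : ℝ)|)

/-- The `γ`-graph dimension: the supremum in `ℕ ∪ {∞}` of the sizes of the `γ`-graph shattered
samples. (For `γ ≥ 0` the points of a shattered sample are automatically distinct.) -/
noncomputable def graphDim {X : Type u} (H : Set (X → unitInterval)) (γ : ℝ) : ℕ∞ :=
  ⨆ (n : ℕ) (_ : ∃ S : Fin n → X, GraphShattered H γ S), (n : ℕ∞)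

/-- A deterministic learning algorithm: it maps every finite labeled sample, of any size, to a
function from `X` to `[0,1]`. -/
abbrev Learner (X : Type u) : Type u :=
  (n : ℕ) → (Fin n → X × unitInterval) → (X → unitInterval)

/-- The labeled training set obtained from the points `S` and the target `h`. -/
def labeled {X : Type u} (h : X → unitInterval) {n : ℕ} (S : Fin n → X) :
    Fin n → X × unitInterval :=
  fun i => (S i, h (S i))

/-- `A` is an ERM for `H`: on each labeled sample realizable by `H` it returns a member of `H`
whose error on the sample is zero. -/
def IsERM {X : Type u} (H : Set (X → unitInterval)) (A : Learner X) : Prop :=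
  ∀ (n : ℕ) (T : Fin n → X × unitInterval), (∃ h ∈ H, ∀ i, h (T i).1 = (T i).2) →
    A n T ∈ H ∧ ∀ i, A n T (T i).1 = (T i).2

/-- Expected absolute loss of `h` against the target `hs`. -/
noncomputable def expectedLoss {X : Type u} [MeasurableSpace X] (D : Measure X)
    (h hs : X → unitInterval) : ℝ≥0∞ :=
  ∫⁻ x, ENNReal.ofReal |(h x : ℝ) - (hs x : ℝ)| ∂D

/-- Cut-off loss at scale `γ` of `h` against the target `hs`. -/
noncomputable def cutoffLoss {X : Type u} [MeasurableSpace X] (D : Measure X) (γ : ℝ)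
    (h hs : X → unitInterval) : ℝ≥0∞ :=
  D {x | γ < |(h x : ℝ) - (hs x : ℝ)|}

/-- With `m` i.i.d. training points, for every distribution and every target in `H`, the expected
loss of `A` is at most `ε` with probability at least `1 - δ`. -/
def PACGuarantee {X : Type u} [MeasurableSpace X] (H : Set (X → unitInterval)) (A : Learner X)
    (ε δ : ℝ) (m : ℕ) : Prop :=
  ∀ (D : Measure X) [IsProbabilityMeasure D], ∀ hs ∈ H,
    Measure.pi (fun _ : Fin m => D)
      {S | ENNReal.ofReal ε < expectedLoss D (A m (labeled hs S)) hs} ≤ ENNReal.ofReal δ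

/-- The same guarantee for the cut-off loss at scale `γ`. -/
def CutoffPACGuarantee {X : Type u} [MeasurableSpace X] (H : Set (X → unitInterval))
    (A : Learner X) (ε δ γ : ℝ) (m : ℕ) : Prop :=
  ∀ (D : Measure X) [IsProbabilityMeasure D], ∀ hs ∈ H,
    Measure.pi (fun _ : Fin m => D)
      {S | ENNReal.ofReal ε < cutoffLoss D γ (A m (labeled hs S)) hs} ≤ ENNReal.ofReal δ

/-- `A` is a PAC learner for `H`. -/
def IsPACLearner {X : Type u} [MeasurableSpace X] (H : Set (X → unitInterval))
    (A : Learner X) : Prop :=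
  ∀ ε ∈ Ioo (0 : ℝ) 1, ∀ δ ∈ Ioo (0 : ℝ) 1, ∃ n : ℕ, PACGuarantee H A ε δ n

/-- Sample complexity of `A`: the least `M` such that the guarantee holds for all sample sizes
`m ≥ M`, and `∞` if there is no such `M`. -/
noncomputable def sampleComplexity {X : Type u} [MeasurableSpace X] (H : Set (X → unitInterval))
    (A : Learner X) (ε δ : ℝ) : ℕ∞ :=
  ⨅ (M : ℕ) (_ : ∀ m ≥ M, PACGuarantee H A ε δ m), (M : ℕ∞)

/-- Cut-off sample complexity of `A`. -/
noncomputable def cutoffSampleComplexity {X : Type u} [MeasurableSpace X]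
    (H : Set (X → unitInterval)) (A : Learner X) (ε δ γ : ℝ) : ℕ∞ :=
  ⨅ (M : ℕ) (_ : ∀ m ≥ M, CutoffPACGuarantee H A ε δ γ m), (M : ℕ∞)

/-- Sample complexity of the worst ERM. -/
noncomputable def ermSampleComplexity {X : Type u} [MeasurableSpace X]
    (H : Set (X → unitInterval)) (ε δ : ℝ) : ℕ∞ :=
  ⨆ (A : Learner X) (_ : IsERM H A), sampleComplexity H A ε δ

/-- Cut-off sample complexity of the worst ERM. -/
noncomputable def ermCutoffSampleComplexity {X : Type u} [MeasurableSpace X]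
    (H : Set (X → unitInterval)) (ε δ γ : ℝ) : ℕ∞ :=
  ⨆ (A : Learner X) (_ : IsERM H A), cutoffSampleComplexity H A ε δ γ

/-- The measure-theoretic regularity of `H` at scale `γ`: for every distribution `D`, target
`hs ∈ H` and `n, k`, the event "some `h ∈ H` agrees with `hs` on the first sample of size `n` and
is more than `γ` away from it at `k` or more positions of an independent second sample of size
`n`" is measurable up to a null set. It holds for instance for countable `H` and for image
admissible Suslin classes. -/
def Admissible {X : Type u} [MeasurableSpace X] (H : Set (X → unitInterval)) (γ : ℝ) : Prop :=
  ∀ (D : Measure X) [IsProbabilityMeasure D], ∀ hs ∈ H, ∀ n k : ℕ,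
    NullMeasurableSet
      {p : (Fin n → X) × (Fin n → X) | ∃ h ∈ H, (∀ i, h (p.1 i) = hs (p.1 i)) ∧
        k ≤ Set.ncard {i : Fin n | γ < |(h (p.2 i) : ℝ) - (hs (p.2 i) : ℝ)|}}
      ((Measure.pi (fun _ : Fin n => D)).prod (Measure.pi (fun _ : Fin n => D)))

/-- Two members of `H` agree at some point and differ by more than `γ` at another one. -/
def Nondegenerate {X : Type u} (H : Set (X → unitInterval)) (γ : ℝ) : Prop :=
  ∃ h ∈ H, ∃ g ∈ H, ∃ x y : X, h x = g x ∧ γ < |(h y : ℝ) - (g y : ℝ)|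

/-!
Fix a target `hs ∈ H` and a scale `γ`. Each `h ∈ H` becomes a partial hypothesis: it has label zero
where `h = hs`, label one where `|h - hs| > γ`, and no label elsewhere. The graph dimension bounds the
size of the samples on which these partial hypotheses realize all patterns of zeros and ones. An ERM
can only fail on a sample in `badSamples`: some partial hypothesis vanishes on the sample although its
ones have probability more than `ε`.

Upper bounds. Symmetrization (`measure_badSamples_le_ghost`, `measure_ghostEvent_le`) reduces the
probability of `badSamples` to a finite question: given `m` pairs of points, choose one point from
each pair at random, and bound the probability that some partial hypothesis vanishes on the chosen
points but has about `ε m` ones. For total hypotheses one would bound the number of hypotheses by the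
Sauer–Shelah lemma. Partial hypotheses have no such count, since a class of small dimension may
require superpolynomially many total ones to extend it. The union bound is instead over sets `Y` of
`O(d)` points: by `exists_doomed` every hypothesis with many ones has such a `Y` among its ones for
which the hypotheses equal to one on `Y` form a `Doomed` set, meaning that vanishing at some of many
points repeatedly makes the set smaller until nothing is left. A random choice survives this with
probability exponentially small in `ε m` (`ncard_surviving_le`), whereas there are only
`(m / d) ^ O(d)` sets `Y`. If no `Y` existed, all patterns would be realized on a proportion
`(3/4) ^ l` of the sequences of `l = 8 (d + 1)` ones, in contradiction to Sauer–Shelah on these `l`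
points.

Lower bounds. Under nondegeneracy a two-point distribution gives the term `log (1 / δ)`, and a
shattered sample with one heavy point gives the dimension, by Markov's inequality for the number of
light points in the sample (`GraphShattered.exists_lt_measure_badSamples`).

The two kinds of loss are related by `γ * cutoff ≤ expected ≤ γ + cutoff`. The risk bound for all
scales simultaneously follows by a union bound over the dimensions `1 ≤ d < n`, because among the
scales of dimension at most `d` there is a least one (`exists_isLeast_graphDim_le`).
-/

/-! ### Random halves and partial hypotheses of bounded dimension -/

/-- The number of subsets of size at most `l` is at most `x⁻ˡ (1 + x)^|T|`. The free parameter `x`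
is what later turns a factor `log m` into `log (1 / ε)`. -/
theorem ncard_finset_card_le_le {T : Type*} [Fintype T] (l : ℕ) {x : ℝ} (hx0 : 0 < x)
    (hx1 : x ≤ 1) :
    x ^ l * (({Y : Finset T | Y.card ≤ l}.ncard : ℕ) : ℝ) ≤ (1 + x) ^ Fintype.card T := by
  classical
  have h1 : {Y : Finset T | Y.card ≤ l}
      = ((Finset.univ.filter fun Y : Finset T => Y.card ≤ l : Finset (Finset T)) :
          Set (Finset T)) := by
    ext; simp
  have h2 := Finset.sum_pow_mul_eq_add_pow x 1 (Finset.univ : Finset T)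
  rw [h1, Set.ncard_coe_finset, add_comm, ← Finset.card_univ, ← h2, mul_comm, ← nsmul_eq_mul,
    Finset.powerset_univ]
  calc _ ≤ ∑ Y ∈ Finset.univ.filter fun Y : Finset T => Y.card ≤ l, x ^ Y.card :=
        Finset.card_nsmul_le_sum _ _ _ fun Y hY =>
          pow_le_pow_of_le_one hx0.le hx1 (Finset.mem_filter.1 hY).2
    _ ≤ ∑ Y : Finset T, x ^ Y.card :=
        Finset.sum_le_sum_of_subset_of_nonneg (Finset.filter_subset _ _) fun _ _ _ => by positivity
    _ = _ := by simp

/-- A set `S` of partially labelled hypotheses (`Z p x`: the hypothesis `p` has label zero at `x`)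
is doomed with rank `r`: for `r = 0` it is empty, and for `r + 1` there are at least `K` points `x`
such that restricting `S` to the hypotheses vanishing at `x` leaves a set that is doomed with
rank `r`. A random sample on which some member of `S` vanishes must then avoid `K` points at all but
`r` steps. -/
def Doomed {P T : Type*} (Z : P → T → Prop) (K : ℕ) : ℕ → Set P → Prop
  | 0, S => S = ∅
  | r + 1, S => K ≤ {x : T | Doomed Z K r {p ∈ S | Z p x}}.ncard

theorem ncard_eq_off_le {ι : Type*} [Fintype ι] (U : Finset ι) (τ : ι → Bool) :
    {σ : ι → Bool | ∀ i ∉ U, σ i = τ i}.ncard ≤ 2 ^ U.card := by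
  classical
  rw [← Finset.card_powerset, ← Set.ncard_coe_finset]
  refine Set.ncard_le_ncard_of_injOn (fun σ => U.filter fun i => σ i = true) ?_ ?_
  · intro σ _
    exact Finset.mem_coe.2 (Finset.mem_powerset.2 (Finset.filter_subset _ _))
  · intro σ hσ ρ hρ h
    funext i
    by_cases hi : i ∈ U
    · have := congrArg (fun A : Finset ι => i ∈ A) h
      simp only [Finset.mem_filter, hi, true_and, eq_iff_iff] at this
      exact Bool.eq_iff_iff.2 this
    · rw [hσ i hi, hρ i hi]

/-- If `S` is doomed with rank `r`, few of the choices `σ` of one point from each pair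
`(i, false), (i, true)` are such that some member of `S` vanishes on all chosen points. The pairs
outside `U` have been decided already, as in `τ`. The next pair to decide is one that contains a
point lowering the rank; the point is chosen with probability `1/2`, and the bound
`2 ^ r * (3 / 4) ^ t` on the proportion is preserved because `1/2 * 2⁻¹ + 1/2 = 3/4`. -/
theorem ncard_surviving_le {ι P : Type*} [Fintype ι] [DecidableEq ι] (Z : P → ι × Bool → Prop)
    (K t : ℕ) : ∀ (r : ℕ) (S : Set P) (U : Finset ι) (τ : ι → Bool), Doomed Z K r S →
      2 * (Uᶜ.card + t) ≤ K →
      (({σ : ι → Bool | (∀ i ∉ U, σ i = τ i) ∧ ∃ p ∈ S, ∀ i, Z p (i, σ i)}.ncard : ℕ) : ℝ)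
        ≤ 2 ^ r * (3 / 4) ^ t * 2 ^ U.card := by
  induction t with
  | zero =>
    intro r S U τ _ _
    have h1 : {σ : ι → Bool | (∀ i ∉ U, σ i = τ i) ∧ ∃ p ∈ S, ∀ i, Z p (i, σ i)}.ncard
        ≤ 2 ^ U.card :=
      (Set.ncard_le_ncard (fun σ hσ => hσ.1) (Set.toFinite _)).trans (ncard_eq_off_le U τ)
    have h2 : (1 : ℝ) ≤ 2 ^ r := one_le_pow₀ (by norm_num)
    calc _ ≤ ((2 ^ U.card : ℕ) : ℝ) := by exact_mod_cast h1
      _ = 1 * 2 ^ U.card := by push_cast; ring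
      _ ≤ _ := by rw [pow_zero, mul_one]; gcongr
  | succ t ih =>
    intro r S U τ hD hK
    cases r with
    | zero =>
      have : S = ∅ := hD
      subst this
      simp only [Set.mem_empty_iff_false, false_and, exists_false, and_false]
      simp only [Set.ofPred_false, Set.ncard_empty, Nat.cast_zero]
      positivity
    | succ r =>
      have hD' : K ≤ {x : ι × Bool | Doomed Z K r {p ∈ S | Z p x}}.ncard := hD
      -- fewer than `K` points lie in decided pairs
      obtain ⟨⟨i, b⟩, hx, hi⟩ : ∃ x : ι × Bool, Doomed Z K r {p ∈ S | Z p x} ∧ x.1 ∈ U := by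
        by_contra hcon
        push Not at hcon
        have hsub : {x : ι × Bool | Doomed Z K r {p ∈ S | Z p x}}
            ⊆ ((Uᶜ ×ˢ Finset.univ : Finset (ι × Bool)) : Set (ι × Bool)) := by
          intro x hx
          simpa using hcon x hx
        have := Set.ncard_le_ncard hsub (Set.toFinite _)
        rw [Set.ncard_coe_finset, Finset.card_product, Finset.card_univ, Fintype.card_bool] at this
        omega
      have hUc : (U.erase i)ᶜ.card = Uᶜ.card + 1 := by
        rw [Finset.compl_erase, Finset.card_insert_of_notMem (by simpa using hi)]
      have hU : U.card = (U.erase i).card + 1 := (Finset.card_erase_add_one hi).symm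
      have hK' : 2 * ((U.erase i)ᶜ.card + t) ≤ K := by omega
      have h1 := ih r {p ∈ S | Z p (i, b)} (U.erase i) (Function.update τ i b) hx hK'
      have h2 := ih (r + 1) S (U.erase i) (Function.update τ i (!b)) hD hK'
      have hsub : {σ : ι → Bool | (∀ j ∉ U, σ j = τ j) ∧ ∃ p ∈ S, ∀ j, Z p (j, σ j)} ⊆
          {σ : ι → Bool | (∀ j ∉ U.erase i, σ j = Function.update τ i b j) ∧
            ∃ p ∈ {p ∈ S | Z p (i, b)}, ∀ j, Z p (j, σ j)} ∪
          {σ : ι → Bool | (∀ j ∉ U.erase i, σ j = Function.update τ i (!b) j) ∧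
            ∃ p ∈ S, ∀ j, Z p (j, σ j)} := by
        rintro σ ⟨hσ, p, hp, hZ⟩
        have key : ∀ c, σ i = c → ∀ j ∉ U.erase i, σ j = Function.update τ i c j := by
          intro c hc j hj
          by_cases hji : j = i
          · subst hji; simpa using hc
          · rw [Function.update_of_ne hji]
            exact hσ j fun h => hj (Finset.mem_erase.2 ⟨hji, h⟩)
        by_cases hb : σ i = b
        · exact Or.inl ⟨key b hb, p, ⟨hp, hb ▸ hZ i⟩, hZ⟩
        · exact Or.inr ⟨key _ (by revert hb; cases σ i <;> cases b <;> simp), p, hp, hZ⟩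
      have h3 := (Set.ncard_le_ncard hsub (Set.toFinite _)).trans (Set.ncard_union_le _ _)
      refine (Nat.cast_le.2 h3).trans ?_
      rw [hU]
      push_cast
      refine (add_le_add h1 h2).trans (le_of_eq ?_)
      ring

/-- If `S` is not doomed, most sequences of points of a large set `O` are zeros of some common
member of `S`. -/
theorem pow_le_ncard_of_not_doomed {P T : Type*} [Finite T] (Z : P → T → Prop) (K : ℕ)
    (O : Finset T) (r : ℕ) : ∀ S : Set P, ¬ Doomed Z K r S →
      (O.card - K) ^ r ≤ {z : Fin r → T | (∀ i, z i ∈ O) ∧ ∃ p ∈ S, ∀ i, Z p (z i)}.ncard := by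
  classical
  induction r with
  | zero =>
    intro S hS
    obtain ⟨p, hp⟩ := Set.nonempty_iff_ne_empty.2 hS
    rw [pow_zero, Nat.one_le_iff_ne_zero, ← Nat.pos_iff_ne_zero, Set.ncard_pos (Set.toFinite _)]
    exact ⟨Fin.elim0, fun i => i.elim0, p, hp, fun i => i.elim0⟩
  | succ r ih =>
    intro S hS
    have hS' : {x : T | Doomed Z K r {p ∈ S | Z p x}}.ncard < K := not_le.1 hS
    set B := O.filter fun x => ¬ Doomed Z K r {p ∈ S | Z p x} with hB
    have hBcard : O.card - K ≤ B.card := by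
      have h1 : (O.filter fun x => Doomed Z K r {p ∈ S | Z p x}).card + B.card = O.card :=
        Finset.card_filter_add_card_filter_not _
      have h2 : (O.filter fun x => Doomed Z K r {p ∈ S | Z p x}).card
          ≤ {x : T | Doomed Z K r {p ∈ S | Z p x}}.ncard := by
        rw [← Set.ncard_coe_finset]
        exact Set.ncard_le_ncard (fun x hx => by simpa using (Finset.mem_filter.1 hx).2)
          (Set.toFinite _)
      omega
    let F : T → Finset (Fin r → T) := fun x =>
      (Set.toFinite {z : Fin r → T | (∀ i, z i ∈ O) ∧ ∃ p ∈ {p ∈ S | Z p x}, ∀ i, Z p (z i)}).toFinset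
    calc (O.card - K) ^ (r + 1) = (O.card - K) * (O.card - K) ^ r := by ring
      _ ≤ B.card * (O.card - K) ^ r := by gcongr
      _ ≤ ∑ x ∈ B, (F x).card := by
        rw [← smul_eq_mul]
        refine Finset.card_nsmul_le_sum _ _ _ fun x hx => ?_
        have := ih _ (Finset.mem_filter.1 hx).2
        rwa [Set.ncard_eq_toFinset_card _ (Set.toFinite _)] at this
      _ = (B.sigma F).card := (Finset.card_sigma _ _).symm
      _ = ((B.sigma F : Finset _) : Set ((_ : T) × (Fin r → T))).ncard :=
        (Set.ncard_coe_finset _).symm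
      _ ≤ _ := by
        refine Set.ncard_le_ncard_of_injOn
          (fun a : (_ : T) × (Fin r → T) => (Fin.cons a.1 a.2 : Fin (r + 1) → T)) ?_ ?_
        · rintro ⟨x, z⟩ hxz
          simp only [Finset.mem_coe, Finset.mem_sigma, F, Set.Finite.mem_toFinset,
            Set.mem_ofPred_eq] at hxz
          obtain ⟨hx, hz, p, ⟨hp, hpx⟩, hpz⟩ := hxz
          refine ⟨fun i => ?_, p, hp, fun i => ?_⟩
          · refine Fin.cases ?_ (fun j => ?_) i
            · exact (Finset.mem_filter.1 hx).1
            · exact hz j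
          · refine Fin.cases ?_ (fun j => ?_) i
            · exact hpx
            · exact hpz j
        · rintro ⟨x, z⟩ _ ⟨y, w⟩ _ h
          obtain ⟨h1, h2⟩ := Fin.cons_inj.1 h
          subst h1; subst h2; rfl

/-- The Sauer–Shelah bound for the total patterns realized on a sequence `Y` by partial
hypotheses (`Z`: label zero, `O`: label one) that shatter no sequence of length `d + 1`. -/
theorem ncard_realized_patterns_le {P T : Type*} (Z O : P → T → Prop) (d l : ℕ)
    (hVC : ∀ Y : Fin (d + 1) → T, ∃ b : Fin (d + 1) → Bool, ∀ p, ∃ i,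
      ¬ ((b i = false → Z p (Y i)) ∧ (b i = true → O p (Y i))))
    (Y : Fin l → T) :
    (({b : Fin l → Bool | ∃ p, ∀ i, (b i = false → Z p (Y i)) ∧ (b i = true → O p (Y i))}.ncard
      : ℕ) : ℝ) ≤ 8 ^ d * (9 / 8) ^ l := by
  classical
  let 𝒜 : Finset (Finset (Fin l)) := Finset.univ.filter fun s =>
    ∃ p, ∀ i, (i ∉ s → Z p (Y i)) ∧ (i ∈ s → O p (Y i))
  have h1 : {b : Fin l → Bool | ∃ p, ∀ i, (b i = false → Z p (Y i)) ∧
      (b i = true → O p (Y i))}.ncard ≤ 𝒜.card := by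
    rw [← Set.ncard_coe_finset]
    refine Set.ncard_le_ncard_of_injOn (fun b => Finset.univ.filter fun i => b i = true) ?_ ?_
    · rintro b ⟨p, hp⟩
      simp only [Finset.mem_coe, 𝒜, Finset.mem_filter, Finset.mem_univ, true_and]
      exact ⟨p, fun i => ⟨fun h => (hp i).1 (by simpa using h), (hp i).2⟩⟩
    · intro b _ c _ h
      funext i
      have := congrArg (fun A : Finset (Fin l) => i ∈ A) h
      simp only [Finset.mem_filter, Finset.mem_univ, true_and, eq_iff_iff] at this
      exact Bool.eq_iff_iff.2 this
  have h2 : 𝒜.card ≤ {s : Finset (Fin l) | s.card ≤ d}.ncard := by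
    refine (Finset.card_le_card_shatterer 𝒜).trans ?_
    rw [← Set.ncard_coe_finset]
    refine Set.ncard_le_ncard (fun s hs => ?_) (Set.toFinite _)
    have hs : 𝒜.Shatters s := Finset.mem_shatterer.1 hs
    by_contra hcard
    have hcard : d + 1 ≤ s.card := by simpa using hcard
    let e : Fin (d + 1) → Fin l := fun i => s.orderEmbOfFin rfl (Fin.castLE hcard i)
    have he : Function.Injective e := fun i j h => by simpa [e] using h
    have hes : ∀ i, e i ∈ s := fun i => Finset.orderEmbOfFin_mem _ _ _
    obtain ⟨b, hb⟩ := hVC (Y ∘ e)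
    obtain ⟨v, hv, hsv⟩ := hs (t := (Finset.univ.filter fun i => b i = true).image e)
      (by intro x hx; obtain ⟨i, _, rfl⟩ := Finset.mem_image.1 hx; exact hes i)
    obtain ⟨p, hp⟩ := (Finset.mem_filter.1 hv).2
    obtain ⟨i, hi⟩ := hb p
    have hiff : e i ∈ v ↔ b i = true := by
      have := congrArg (fun A : Finset (Fin l) => e i ∈ A) hsv
      simpa [hes i, he.eq_iff] using this
    exact hi ⟨fun h => (hp (e i)).1 (by rw [hiff]; simp [h]), fun h => (hp (e i)).2 (hiff.2 h)⟩
  have h3 := ncard_finset_card_le_le (T := Fin l) d (x := 1 / 8) (by norm_num) (by norm_num)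
  have h4 := Nat.cast_le (α := ℝ).2 (h1.trans h2)
  refine h4.trans ?_
  rw [Fintype.card_fin] at h3
  have h5 : (8 : ℝ) ^ d * (1 / 8) ^ d = 1 := by rw [← mul_pow]; norm_num
  calc _ = 8 ^ d * ((1 / 8) ^ d * (({s : Finset (Fin l) | s.card ≤ d}.ncard : ℕ) : ℝ)) := by
        rw [← mul_assoc, h5, one_mul]
    _ ≤ 8 ^ d * (1 + 1 / 8) ^ l := by gcongr
    _ = _ := by norm_num

/-- Every hypothesis `p` with at least `4 K` ones has a set `Y` of at most `8 (d + 1)` ones such that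
the hypotheses equal to one on `Y` form a doomed set. Otherwise each pattern on `l = 8 (d + 1)`
positions would be realized on a proportion `(3/4) ^ l` of the sequences of ones of `p`: take the
prescribed ones first, then the zeros by `pow_le_ncard_of_not_doomed`. That makes
`2 ^ l * (3/4) ^ l` patterns on average, more than `ncard_realized_patterns_le` allows. -/
theorem exists_doomed {P T : Type*} [Fintype T] (Z O : P → T → Prop) (d K : ℕ)
    (hVC : ∀ Y : Fin (d + 1) → T, ∃ b : Fin (d + 1) → Bool, ∀ p, ∃ i,
      ¬ ((b i = false → Z p (Y i)) ∧ (b i = true → O p (Y i))))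
    (p : P) (hK : 4 * K ≤ {x | O p x}.ncard) (hpos : 0 < {x | O p x}.ncard) :
    ∃ Y : Finset T, Y.card ≤ 8 * (d + 1) ∧ (∀ y ∈ Y, O p y) ∧
      Doomed Z K (8 * (d + 1)) {q | ∀ y ∈ Y, O q y} := by
  classical
  by_contra! hcon
  set l := 8 * (d + 1) with hl
  let Op : Finset T := Finset.univ.filter fun x => O p x
  have hOp : {x | O p x}.ncard = Op.card := by
    rw [← Set.ncard_coe_finset]; congr 1; ext; simp [Op]
  rw [hOp] at hK hpos
  -- `R b`: the sequences of ones of `p` on which the pattern `b` is realized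
  let R : (Fin l → Bool) → Finset (Fin l → T) := fun b =>
    (Fintype.piFinset fun _ => Op).filter fun Y =>
      ∃ p, ∀ i, (b i = false → Z p (Y i)) ∧ (b i = true → O p (Y i))
  have hR : ∀ b, (Op.card - K) ^ l ≤ (R b).card := by
    intro b
    -- Pairs `(u, v)`: the ones of the pattern are placed along `u` and the zeros along `v`. Sorting
    -- the entries of `u` and `v` into those used and those unused by `b` is injective.
    let A : Finset ((Fin l → T) × (Fin l → T)) :=
      (Fintype.piFinset fun _ => Op).sigma (fun u =>
        (Fintype.piFinset fun _ => Op).filter fun v => ∃ q, (∀ i, b i = true → O q (u i)) ∧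
          ∀ i, Z q (v i)) |>.map (Equiv.sigmaEquivProd _ _).toEmbedding
    have hA1 : Op.card ^ l * (Op.card - K) ^ l ≤ A.card := by
      rw [Finset.card_map, Finset.card_sigma]
      have : Op.card ^ l = (Fintype.piFinset fun _ : Fin l => Op).card := by simp
      rw [this, ← smul_eq_mul]
      refine Finset.card_nsmul_le_sum _ _ _ fun u hu => ?_
      have hu : ∀ i, u i ∈ Op := Fintype.mem_piFinset.1 hu
      have h1 := pow_le_ncard_of_not_doomed Z K Op l _
        (hcon ((Finset.univ.filter fun i => b i = true).image u)
          (Finset.card_image_le.trans ((Finset.card_filter_le _ _).trans (by simp)))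
          (by
            intro y hy
            obtain ⟨i, _, rfl⟩ := Finset.mem_image.1 hy
            exact (Finset.mem_filter.1 (hu i)).2))
      refine h1.trans ?_
      rw [← Set.ncard_coe_finset]
      refine Set.ncard_le_ncard ?_ (Set.toFinite _)
      rintro z ⟨hz, q, hq, hqz⟩
      simp only [Finset.coe_filter, Fintype.mem_piFinset, Set.mem_ofPred_eq]
      exact ⟨hz, q, fun i hi => hq _ (Finset.mem_image.2 ⟨i, by simpa using hi, rfl⟩), hqz⟩
    have hA2 : A.card ≤ (R b).card * Op.card ^ l := by
      have : Op.card ^ l = (Fintype.piFinset fun _ : Fin l => Op).card := by simp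
      rw [this, ← Finset.card_product]
      refine Finset.card_le_card_of_injOn
        (fun a => (fun i => if b i = true then a.1 i else a.2 i,
          fun i => if b i = true then a.2 i else a.1 i)) ?_ ?_
      · rintro ⟨u, v⟩ huv
        obtain ⟨⟨u', v'⟩, h, h'⟩ := Finset.mem_map.1 huv
        obtain ⟨rfl, rfl⟩ : u' = u ∧ v' = v := by simpa using h'
        obtain ⟨hu, hv⟩ := Finset.mem_sigma.1 h
        have hu : ∀ i, u' i ∈ Op := Fintype.mem_piFinset.1 hu
        obtain ⟨hv, q, hq1, hq0⟩ := Finset.mem_filter.1 hv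
        have hv : ∀ i, v' i ∈ Op := Fintype.mem_piFinset.1 hv
        refine Finset.mem_product.2 ⟨Finset.mem_filter.2 ⟨Fintype.mem_piFinset.2 fun i => ?_,
          q, fun i => ⟨fun hi => ?_, fun hi => ?_⟩⟩, Fintype.mem_piFinset.2 fun i => ?_⟩
        · dsimp only; split_ifs <;> [exact hu i; exact hv i]
        · simpa [hi] using hq0 i
        · simpa [hi] using hq1 i hi
        · dsimp only; split_ifs <;> [exact hv i; exact hu i]
      · rintro ⟨u, v⟩ _ ⟨u', v'⟩ _ h
        obtain ⟨h1, h2⟩ := Prod.ext_iff.1 h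
        have h1 := fun i => congrFun h1 i
        have h2 := fun i => congrFun h2 i
        ext i <;> have h1 := h1 i <;> have h2 := h2 i <;> dsimp only at h1 h2 ⊢ <;>
          split_ifs at h1 h2 <;> assumption
    have := hA1.trans hA2
    rw [mul_comm] at this
    exact Nat.le_of_mul_le_mul_right this (by positivity)
  -- double counting of the pairs (pattern, sequence realizing it)
  have hcount : ((2 : ℝ) ^ l) * ((Op.card - K : ℕ) : ℝ) ^ l
      ≤ (Op.card : ℝ) ^ l * (8 ^ d * (9 / 8) ^ l) := by
    have h1 : ((∑ b, (R b).card : ℕ) : ℝ)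
        = ∑ Y ∈ Fintype.piFinset fun _ : Fin l => Op,
          (((Finset.univ.filter fun b : Fin l → Bool => ∃ p, ∀ i, (b i = false → Z p (Y i)) ∧
            (b i = true → O p (Y i))).card : ℕ) : ℝ) := by
      rw [← Nat.cast_sum]
      congr 1
      simp only [R, Finset.card_filter]
      exact Finset.sum_comm
    calc _ = ∑ _b : Fin l → Bool, ((Op.card - K : ℕ) : ℝ) ^ l := by simp
      _ ≤ ∑ b, ((R b).card : ℝ) := Finset.sum_le_sum fun b _ => by exact_mod_cast hR b
      _ = ((∑ b, (R b).card : ℕ) : ℝ) := by push_cast; rfl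
      _ = _ := h1
      _ ≤ ∑ _Y ∈ Fintype.piFinset fun _ : Fin l => Op, (8 ^ d * (9 / 8 : ℝ) ^ l) := by
        refine Finset.sum_le_sum fun Y _ => ?_
        refine le_trans (le_of_eq ?_) (ncard_realized_patterns_le Z O d l hVC Y)
        rw [← Set.ncard_coe_finset]
        congr 2
        ext; simp
      _ = _ := by rw [Finset.sum_const, nsmul_eq_mul]; simp
  have hOK : (3 / 4 : ℝ) * Op.card ≤ ((Op.card - K : ℕ) : ℝ) := by
    rw [Nat.cast_sub (by omega)]
    have : (4 : ℝ) * K ≤ Op.card := by exact_mod_cast hK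
    linarith
  have hO : (0 : ℝ) < (Op.card : ℝ) ^ l := by positivity
  have h3 : (2 : ℝ) ^ l * ((3 / 4) ^ l * (Op.card : ℝ) ^ l)
      ≤ (Op.card : ℝ) ^ l * (8 ^ d * (9 / 8) ^ l) := by
    refine le_trans ?_ hcount
    rw [← mul_pow (3 / 4 : ℝ)]
    gcongr
  have h4 : (2 : ℝ) ^ l * (3 / 4) ^ l ≤ 8 ^ d * (9 / 8) ^ l := by
    refine le_of_mul_le_mul_left ?_ hO
    linarith
  have h5 : (2 : ℝ) ^ l * (3 / 4) ^ l = (4 / 3) ^ l * (9 / 8) ^ l := by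
    rw [← mul_pow, ← mul_pow]; norm_num
  have h6 : (4 / 3 : ℝ) ^ l ≤ 8 ^ d := le_of_mul_le_mul_right (h5 ▸ h4) (by positivity)
  have h7 : (8 : ℝ) ^ (d + 1) ≤ (4 / 3) ^ l := by
    rw [hl, pow_mul]; gcongr; norm_num
  have h8 : (8 : ℝ) ^ d < 8 ^ (d + 1) := pow_lt_pow_right₀ (by norm_num) (by omega)
  linarith

/-- The combinatorial core: the probability that some hypothesis with at least `8 t` ones vanishes on
a random choice of one point from each pair is exponentially small in `t`. The union bound runs
over the small sets `Y` of `exists_doomed`, not over the (possibly far more numerous) hypotheses. -/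
theorem ncard_bad_swaps_le {ι P : Type*} [Fintype ι] (Z O : P → ι × Bool → Prop)
    (d t : ℕ) (ht : 0 < t)
    (hVC : ∀ Y : Fin (d + 1) → ι × Bool, ∃ b : Fin (d + 1) → Bool, ∀ p, ∃ i,
      ¬ ((b i = false → Z p (Y i)) ∧ (b i = true → O p (Y i)))) :
    (({σ : ι → Bool | ∃ p, (∀ i, Z p (i, σ i)) ∧ 8 * t ≤ {x | O p x}.ncard}.ncard : ℕ) : ℝ) ≤
      (({Y : Finset (ι × Bool) | Y.card ≤ 8 * (d + 1)}.ncard : ℕ) : ℝ) *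
        (2 ^ (8 * (d + 1)) * (3 / 4) ^ t * 2 ^ Fintype.card ι) := by
  classical
  set l := 8 * (d + 1)
  let F : Finset (Finset (ι × Bool)) := Finset.univ.filter fun Y => Y.card ≤ l ∧
    Doomed Z (2 * t) l {q | ∀ y ∈ Y, O q y}
  let W : Finset (ι × Bool) → Finset (ι → Bool) := fun Y =>
    Finset.univ.filter fun σ => ∃ q, (∀ y ∈ Y, O q y) ∧ ∀ i, Z q (i, σ i)
  have hsub : {σ : ι → Bool | ∃ p, (∀ i, Z p (i, σ i)) ∧ 8 * t ≤ {x | O p x}.ncard}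
      ⊆ (F.biUnion W : Finset (ι → Bool)) := by
    rintro σ ⟨p, hZ, hO⟩
    obtain ⟨Y, hY, hYO, hD⟩ := exists_doomed Z O d (2 * t) hVC p (by omega) (by omega)
    rw [Finset.mem_coe, Finset.mem_biUnion]
    exact ⟨Y, Finset.mem_filter.2 ⟨Finset.mem_univ _, hY, hD⟩,
      Finset.mem_filter.2 ⟨Finset.mem_univ _, p, hYO, hZ⟩⟩
  have hW : ∀ Y ∈ F, ((W Y).card : ℝ) ≤ 2 ^ l * (3 / 4) ^ t * 2 ^ Fintype.card ι := by
    intro Y hY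
    have h := ncard_surviving_le Z (2 * t) t l {q | ∀ y ∈ Y, O q y} Finset.univ (fun _ => true)
      (Finset.mem_filter.1 hY).2.2 (by simp)
    rw [Finset.card_univ] at h
    refine le_trans (le_of_eq ?_) h
    rw [← Set.ncard_coe_finset]
    congr 2
    ext; simp [W]
  have hF : F.card ≤ {Y : Finset (ι × Bool) | Y.card ≤ l}.ncard := by
    rw [← Set.ncard_coe_finset]
    exact Set.ncard_le_ncard (fun Y hY => (Finset.mem_filter.1 hY).2.1) (Set.toFinite _)
  calc _ ≤ (((F.biUnion W).card : ℕ) : ℝ) := by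
        rw [← Set.ncard_coe_finset]
        exact_mod_cast Set.ncard_le_ncard hsub (Set.toFinite _)
    _ ≤ ∑ Y ∈ F, ((W Y).card : ℝ) := by exact_mod_cast Finset.card_biUnion_le
    _ ≤ F.card • (2 ^ l * (3 / 4) ^ t * 2 ^ Fintype.card ι) := Finset.sum_le_card_nsmul _ _ _ hW
    _ ≤ _ := by
      rw [nsmul_eq_mul]
      gcongr

/-! ### Symmetrization by a ghost sample -/

/-- A set of mass more than `ε` contains at least `ε m / 4` of `m` sample points with probability at
least `1/2`. This is the exponential Markov inequality for `2 ^ (-N)`, where `N` is the number of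
the points. -/
theorem measure_ncard_lt_le_half {X : Type*} [MeasurableSpace X] (D : Measure X)
    [IsProbabilityMeasure D] {V : Set X} (hV : MeasurableSet V) {ε : ℝ} {m k : ℕ}
    (hp : ENNReal.ofReal ε < D V) (hk : (k : ℝ) ≤ ε * m / 4) (hm : 4 ≤ ε * m) :
    Measure.pi (fun _ : Fin m => D) {s | {i | s i ∈ V}.ncard < k} ≤ 1 / 2 := by
  classical
  set μ := Measure.pi (fun _ : Fin m => D)
  let f : X → ℝ := fun x => 1 - V.indicator (fun _ => (1 / 2 : ℝ)) x
  have hfm : Measurable f := measurable_const.sub (measurable_const.indicator hV)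
  have hf : ∀ x, f x = if x ∈ V then 1 / 2 else 1 := by
    intro x; by_cases hx : x ∈ V <;> simp [f, hx]; norm_num
  have hpε : ε ≤ D.real V := by
    rw [measureReal_def]
    exact (ENNReal.ofReal_le_iff_le_toReal (measure_ne_top _ _)).1 hp.le
  have hint : ∫ x, f x ∂D = 1 - D.real V / 2 := by
    rw [integral_sub (integrable_const _) ((integrable_const _).indicator hV),
      integral_indicator_const _ hV]
    simp; ring
  have hprod : ∀ s : Fin m → X, ∏ i, f (s i) = (1 / 2 : ℝ) ^ {i | s i ∈ V}.ncard := by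
    intro s
    have : {i | s i ∈ V}.ncard = (Finset.univ.filter fun i => s i ∈ V).card := by
      rw [← Set.ncard_coe_finset]; congr 1; ext; simp
    rw [this]
    simp only [hf, Finset.prod_ite, Finset.prod_const, one_pow, mul_one]
  have h1 : ∫ s, ∏ i, f (s i) ∂μ = (1 - D.real V / 2) ^ m := by
    rw [integral_fintype_prod_eq_pow, hint, Fintype.card_fin]
  have hle1 : ∀ s : Fin m → X, ∏ i, f (s i) ≤ 1 := fun s => by
    rw [hprod]; exact pow_le_one₀ (by norm_num) (by norm_num)
  have h0 : ∀ s : Fin m → X, 0 ≤ ∏ i, f (s i) := fun s => by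
    rw [hprod]; positivity
  have h2 := mul_meas_ge_le_integral_of_nonneg (μ := μ) (f := fun s => ∏ i, f (s i))
    (Filter.Eventually.of_forall h0) (Integrable.of_bound (C := 1)
      (Measurable.aestronglyMeasurable (by fun_prop))
      (Filter.Eventually.of_forall fun s => by
        rw [Real.norm_eq_abs, abs_of_nonneg (h0 s)]; exact hle1 s)) ((1 / 2) ^ k)
  rw [h1] at h2
  have h3 : (1 - D.real V / 2) ^ m ≤ Real.exp (-(ε * m / 2)) := by
    have hD1 : D.real V ≤ 1 := measureReal_le_one
    calc (1 - D.real V / 2) ^ m ≤ (Real.exp (-(ε / 2))) ^ m := by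
          refine pow_le_pow_left₀ (by linarith) ?_ m
          have := Real.add_one_le_exp (-(ε / 2))
          linarith
      _ = _ := by rw [← Real.exp_nat_mul]; congr 1; ring
  have he : (2 : ℝ) ≤ Real.exp 1 := by
    have := Real.add_one_le_exp (1 : ℝ); linarith
  have h4 : (2 : ℝ) ^ k ≤ Real.exp (ε * m / 4) := by
    calc (2 : ℝ) ^ k ≤ Real.exp 1 ^ k := by gcongr
      _ = Real.exp k := by rw [← Real.exp_nat_mul, mul_one]
      _ ≤ _ := Real.exp_le_exp.2 hk
  have h5 : μ.real {s | (1 / 2 : ℝ) ^ k ≤ ∏ i, f (s i)} ≤ 1 / 2 := by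
    have h6 : (2 : ℝ) ^ k * (1 / 2) ^ k = 1 := by rw [← mul_pow]; norm_num
    calc μ.real {s | (1 / 2 : ℝ) ^ k ≤ ∏ i, f (s i)}
        = 2 ^ k * ((1 / 2) ^ k * μ.real {s | (1 / 2 : ℝ) ^ k ≤ ∏ i, f (s i)}) := by
          rw [← mul_assoc, h6, one_mul]
      _ ≤ Real.exp (ε * m / 4) * Real.exp (-(ε * m / 2)) := by
          gcongr
          exact h2.trans h3
      _ = Real.exp (-(ε * m / 4)) := by rw [← Real.exp_add]; congr 1; ring
      _ ≤ Real.exp (-1) := Real.exp_le_exp.2 (by linarith)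
      _ ≤ 1 / 2 := by
        rw [Real.exp_neg, one_div]
        exact inv_anti₀ (by norm_num) he
  calc μ {s | {i | s i ∈ V}.ncard < k} ≤ μ {s | (1 / 2 : ℝ) ^ k ≤ ∏ i, f (s i)} := by
        refine measure_mono fun s hs => ?_
        have hs : {i | s i ∈ V}.ncard < k := hs
        change (1 / 2 : ℝ) ^ k ≤ ∏ i, f (s i)
        rw [hprod]
        exact pow_le_pow_of_le_one (by norm_num) (by norm_num) hs.le
    _ ≤ ENNReal.ofReal (1 / 2) := by
        rw [measureReal_def] at h5
        exact (ENNReal.le_ofReal_iff_toReal_le (measure_ne_top _ _) (by norm_num)).2 h5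
    _ = 1 / 2 := by
        rw [ENNReal.ofReal_div_of_pos (by norm_num)]; simp

/-- Exchange of the two halves of a double sample at the positions selected by `σ`. -/
def swapAt {X : Type*} {m : ℕ} (σ : Fin m → Bool) (p : (Fin m → X) × (Fin m → X)) :
    (Fin m → X) × (Fin m → X) :=
  (fun i => if σ i then p.2 i else p.1 i, fun i => if σ i then p.1 i else p.2 i)

theorem measurePreserving_swapAt {X : Type*} [MeasurableSpace X] (D : Measure X)
    [IsProbabilityMeasure D] {m : ℕ} (σ : Fin m → Bool) :
    MeasurePreserving (swapAt (X := X) σ)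
      ((Measure.pi fun _ : Fin m => D).prod (Measure.pi fun _ : Fin m => D))
      ((Measure.pi fun _ : Fin m => D).prod (Measure.pi fun _ : Fin m => D)) := by
  have e := measurePreserving_arrowProdEquivProdArrow X X (Fin m) (fun _ => D) (fun _ => D)
  have hsw : MeasurePreserving
      (fun (q : Fin m → X × X) i => if σ i then (q i).swap else q i)
      (Measure.pi fun _ => D.prod D) (Measure.pi fun _ => D.prod D) := by
    refine measurePreserving_pi (fun _ : Fin m => D.prod D) (fun _ : Fin m => D.prod D)
      (f := fun i (x : X × X) => if σ i then x.swap else x) fun i => ?_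
    by_cases h : σ i
    · simp only [h, if_true]; exact Measure.measurePreserving_swap
    · simp only [h]; exact MeasurePreserving.id _
  have := (e.comp hsw).comp (e.symm _)
  convert this using 1
  funext p
  refine Prod.ext (funext fun i => ?_) (funext fun i => ?_) <;>
    by_cases h : σ i <;>
    simp [swapAt, MeasurableEquiv.arrowProdEquivProdArrow, Equiv.arrowProdEquivProdArrow, h]

theorem graphShattered_le_graphDim {X : Type u} {H : Set (X → unitInterval)} {γ : ℝ} {n : ℕ}
    {S : Fin n → X} (h : GraphShattered H γ S) : (n : ℕ∞) ≤ graphDim H γ :=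
  le_iSup₂_of_le (f := fun (n : ℕ) (_ : ∃ S : Fin n → X, GraphShattered H γ S) => (n : ℕ∞))
    n ⟨S, h⟩ le_rfl

/-- The event on a double sample that some `h ∈ H` agrees with `hs` on the first half and is more
than `γ` away from it at `k` or more positions of the second half. -/
def ghostEvent {X : Type u} (H : Set (X → unitInterval)) (γ : ℝ) (hs : X → unitInterval)
    (n k : ℕ) : Set ((Fin n → X) × (Fin n → X)) :=
  {p | ∃ h ∈ H, (∀ i, h (p.1 i) = hs (p.1 i)) ∧
        k ≤ Set.ncard {i : Fin n | γ < |(h (p.2 i) : ℝ) - (hs (p.2 i) : ℝ)|}}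

theorem ncard_swaps_ghostEvent_le {X : Type u} {H : Set (X → unitInterval)} {γ : ℝ}
    {hs : X → unitInterval} {m d t : ℕ} (hd : graphDim H γ ≤ d) (ht : 0 < t)
    (p : (Fin m → X) × (Fin m → X)) :
    (({σ : Fin m → Bool | swapAt σ p ∈ ghostEvent H γ hs m (8 * t)}.ncard : ℕ) : ℝ) ≤
      (({Y : Finset (Fin m × Bool) | Y.card ≤ 8 * (d + 1)}.ncard : ℕ) : ℝ) *
        (2 ^ (8 * (d + 1)) * (3 / 4) ^ t * 2 ^ m) := by
  let pt : Fin m × Bool → X := fun x => if x.2 then p.2 x.1 else p.1 x.1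
  have h := ncard_bad_swaps_le (ι := Fin m) (P := H) (fun q x => q.1 (pt x) = hs (pt x))
    (fun q x => γ < |(q.1 (pt x) : ℝ) - (hs (pt x) : ℝ)|) d t ht ?_
  · rw [Fintype.card_fin] at h
    refine le_trans (Nat.cast_le.2 (Set.ncard_le_ncard ?_ (Set.toFinite _))) h
    rintro σ ⟨q, hq, hcons, hk⟩
    refine ⟨⟨q, hq⟩, fun i => hcons i, hk.trans ?_⟩
    refine Set.ncard_le_ncard_of_injOn (fun i => (i, !σ i)) ?_ ?_ (Set.toFinite _)
    · intro i hi
      have hi : γ < |(q ((swapAt σ p).2 i) : ℝ) - (hs ((swapAt σ p).2 i) : ℝ)| := hi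
      change γ < |(q (pt (i, !σ i)) : ℝ) - (hs (pt (i, !σ i)) : ℝ)|
      have : pt (i, !σ i) = (swapAt σ p).2 i := by
        by_cases hσ : σ i <;> simp [pt, swapAt, hσ]
      rwa [this]
    · intro i _ j _ hij
      exact (Prod.ext_iff.1 hij).1
  · intro Y
    by_contra! hcon
    have hsh : GraphShattered H γ (pt ∘ Y) :=
      ⟨fun i => hs (pt (Y i)), fun b => by
        obtain ⟨q, hq⟩ := hcon b
        exact ⟨q.1, q.2, fun i => hq i⟩⟩
    have := (graphShattered_le_graphDim hsh).trans hd
    rw [Nat.cast_le] at this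
    omega

/-- The ghost event is invariant in law under the swaps `swapAt σ`, so its probability is at most the
largest proportion of swaps that send a fixed double sample into it. Averaging needs the event to be
null measurable. -/
theorem measure_ghostEvent_le {X : Type u} [MeasurableSpace X] {H : Set (X → unitInterval)}
    {γ : ℝ} {hs : X → unitInterval} {m d t : ℕ} (D : Measure X) [IsProbabilityMeasure D]
    (hadm : Admissible H γ) (hhs : hs ∈ H) (hd : graphDim H γ ≤ d) (ht : 0 < t) :
    (Measure.pi fun _ : Fin m => D).prod (Measure.pi fun _ : Fin m => D)
        (ghostEvent H γ hs m (8 * t)) ≤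
      ENNReal.ofReal ((({Y : Finset (Fin m × Bool) | Y.card ≤ 8 * (d + 1)}.ncard : ℕ) : ℝ) *
        (2 ^ (8 * (d + 1)) * (3 / 4) ^ t)) := by
  classical
  set ν := (Measure.pi fun _ : Fin m => D).prod (Measure.pi fun _ : Fin m => D)
  set E := ghostEvent H γ hs m (8 * t) with hE
  set B := (({Y : Finset (Fin m × Bool) | Y.card ≤ 8 * (d + 1)}.ncard : ℕ) : ℝ) *
        (2 ^ (8 * (d + 1)) * (3 / 4) ^ t) with hB
  have hEm : NullMeasurableSet E ν := hadm D hs hhs m (8 * t)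
  have hpre : ∀ σ : Fin m → Bool, NullMeasurableSet (swapAt σ ⁻¹' E) ν := fun σ =>
    hEm.preimage (measurePreserving_swapAt D σ).quasiMeasurePreserving
  have h1 : (2 : ℝ≥0∞) ^ m * ν E ≤ ENNReal.ofReal B * 2 ^ m := by
    calc (2 : ℝ≥0∞) ^ m * ν E = ∑ σ : Fin m → Bool, ν (swapAt σ ⁻¹' E) := by
          rw [Finset.sum_congr rfl fun σ _ => (measurePreserving_swapAt D σ).measure_preimage hEm]
          simp [ν]
      _ = ∑ σ : Fin m → Bool, ∫⁻ p, (swapAt σ ⁻¹' E).indicator 1 p ∂ν := by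
          simp only [lintegral_indicator_one₀ (hpre _)]
      _ = ∫⁻ p, ∑ σ : Fin m → Bool, (swapAt σ ⁻¹' E).indicator 1 p ∂ν := by
          rw [lintegral_finsetSum']
          intro σ _
          exact aemeasurable_one.indicator₀ (hpre σ)
      _ ≤ ∫⁻ _p, ENNReal.ofReal B * 2 ^ m ∂ν := by
          refine lintegral_mono fun p => ?_
          have h2 := ncard_swaps_ghostEvent_le (hs := hs) (m := m) hd ht p
          have h3 : ∑ σ : Fin m → Bool, (swapAt σ ⁻¹' E).indicator
              (1 : (Fin m → X) × (Fin m → X) → ℝ≥0∞) p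
              = (({σ : Fin m → Bool | swapAt σ p ∈ E}.ncard : ℕ) : ℝ≥0∞) := by
            have : {σ : Fin m → Bool | swapAt σ p ∈ E}.ncard
                = (Finset.univ.filter fun σ : Fin m → Bool => swapAt σ p ∈ E).card := by
              rw [← Set.ncard_coe_finset]; congr 1; ext; simp
            rw [this, Finset.card_filter]
            push_cast
            exact Finset.sum_congr rfl fun σ _ => by simp [Set.indicator_apply]
          rw [h3, ← ENNReal.ofReal_natCast]
          have h4 : (2 : ℝ≥0∞) ^ m = ENNReal.ofReal (2 ^ m) := by
            rw [ENNReal.ofReal_pow (by norm_num)]; simp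
          rw [h4, ← ENNReal.ofReal_mul (by positivity)]
          exact ENNReal.ofReal_le_ofReal (h2.trans (le_of_eq (by rw [hB]; ring)))
      _ = _ := by simp [ν]
  rw [mul_comm] at h1
  exact (ENNReal.mul_le_mul_iff_left (by positivity) (by finiteness)).1 h1

/-- The samples of size `m` on which some ERM may have cut-off loss more than `ε`: some `h ∈ H`
agrees with the target on the sample but has larger loss. -/
def badSamples {X : Type u} [MeasurableSpace X] (H : Set (X → unitInterval)) (D : Measure X)
    (γ ε : ℝ) (hs : X → unitInterval) (m : ℕ) : Set (Fin m → X) :=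
  {S | ∃ h ∈ H, (∀ i, h (S i) = hs (S i)) ∧ ENNReal.ofReal ε < cutoffLoss D γ h hs}

theorem measurableSet_deviation {X : Type*} [MeasurableSpace X] {h g : X → unitInterval}
    (hh : Measurable h) (hg : Measurable g) (γ : ℝ) :
    MeasurableSet {x | γ < |(h x : ℝ) - (g x : ℝ)|} :=
  measurableSet_lt measurable_const (by fun_prop)

/-- Symmetrization. It holds for outer measures: the ghost event is replaced by its measurable hull,
which has the same measure and larger sections. -/
theorem measure_badSamples_le_ghost {X : Type u} [MeasurableSpace X] {H : Set (X → unitInterval)}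
    (hH : ∀ h ∈ H, Measurable h) {γ ε : ℝ} {hs : X → unitInterval} {m k : ℕ} (D : Measure X)
    [IsProbabilityMeasure D] (hhs : hs ∈ H) (hk : (k : ℝ) ≤ ε * m / 4) (hm : 4 ≤ ε * m) :
    Measure.pi (fun _ : Fin m => D) (badSamples H D γ ε hs m) ≤
      2 * (Measure.pi fun _ : Fin m => D).prod (Measure.pi fun _ : Fin m => D)
        (ghostEvent H γ hs m k) := by
  set μ := Measure.pi fun _ : Fin m => D
  set E := toMeasurable (μ.prod μ) (ghostEvent H γ hs m k) with hE
  have hEm : MeasurableSet E := measurableSet_toMeasurable _ _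
  have hsub : badSamples H D γ ε hs m ⊆ {r | 1 / 2 ≤ μ (Prod.mk r ⁻¹' E)} := by
    rintro r ⟨h, hh, hcons, hloss⟩
    have h1 := measure_ncard_lt_le_half D (measurableSet_deviation (hH h hh) (hH hs hhs) γ)
      hloss hk hm
    set A : Set (Fin m → X) :=
      {s | {i | s i ∈ {x | γ < |(h x : ℝ) - (hs x : ℝ)|}}.ncard < k}
    have h2 : Aᶜ ⊆ Prod.mk r ⁻¹' E := by
      intro s hsA
      exact subset_toMeasurable _ _ ⟨h, hh, hcons, not_lt.1 hsA⟩
    have h3 : (1 : ℝ≥0∞) ≤ μ A + μ Aᶜ := by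
      rw [← measure_univ (μ := μ), ← Set.union_compl_self A]
      exact measure_union_le _ _
    have h4 : (1 : ℝ≥0∞) ≤ 1 / 2 + μ Aᶜ := h3.trans (by gcongr)
    have h5 : (1 / 2 : ℝ≥0∞) ≤ μ Aᶜ := by
      refine (ENNReal.add_le_add_iff_left (a := 1 / 2) (by simp)).1 ?_
      rwa [ENNReal.add_halves]
    exact h5.trans (measure_mono h2)
  have h6 := mul_meas_ge_le_lintegral (μ := μ) (measurable_measure_prodMk_left (ν := μ) hEm)
    (1 / 2)
  rw [← Measure.prod_apply hEm, hE, measure_toMeasurable] at h6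
  calc μ (badSamples H D γ ε hs m) ≤ μ {r | 1 / 2 ≤ μ (Prod.mk r ⁻¹' E)} := measure_mono hsub
    _ = 2 * (1 / 2 * μ {r | 1 / 2 ≤ μ (Prod.mk r ⁻¹' E)}) := by
      rw [← mul_assoc, one_div, ENNReal.mul_inv_cancel (by norm_num) (by norm_num), one_mul]
    _ ≤ _ := by gcongr

/-! ### Upper bounds on the sample complexity -/

/-- The bound with `t = ⌊ε m / 32⌋`: symmetrization allows `8 t ≤ ε m / 4` ones, and `64 ≤ ε m` makes
`t` at least `ε m / 64`, so that `(3 / 4) ^ t ≤ exp (-ε m / 256)`. The number of sets in the union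
bound costs half of this exponent. -/
theorem measure_badSamples_le_exp {X : Type u} [MeasurableSpace X] {H : Set (X → unitInterval)}
    (hH : ∀ h ∈ H, Measurable h) {γ ε : ℝ} {hs : X → unitInterval} {m d : ℕ} (D : Measure X)
    [IsProbabilityMeasure D] (hadm : Admissible H γ) (hhs : hs ∈ H) (hd : graphDim H γ ≤ d)
    (hε0 : 0 < ε) (hε1 : ε ≤ 1) (hm : 64 ≤ ε * m) :
    Measure.pi (fun _ : Fin m => D) (badSamples H D γ ε hs m) ≤
      ENNReal.ofReal (2 * (2048 / ε) ^ (8 * (d + 1)) * Real.exp (-(ε * m / 512))) := by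
  set t := ⌊ε * m / 32⌋₊ with ht
  set l := 8 * (d + 1) with hl
  have ht1 : (t : ℝ) ≤ ε * m / 32 := Nat.floor_le (by linarith)
  have ht2 : ε * m / 32 < t + 1 := Nat.lt_floor_add_one _
  have htpos : 0 < t := Nat.floor_pos.2 (by linarith)
  have h1 := measure_badSamples_le_ghost hH (k := 8 * t) (γ := γ) (ε := ε) (m := m) D hhs
    (by push_cast; linarith) (by linarith)
  have h2 := measure_ghostEvent_le (m := m) D hadm hhs hd htpos
  -- `x = ε / 1024` makes `(1 + x) ^ (2 m)` at most the square root of `1 / (3 / 4) ^ t`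
  have h3 := ncard_finset_card_le_le (T := Fin m × Bool) l (x := ε / 1024) (by positivity)
    (by linarith)
  rw [← hl] at h2
  set N := (({Y : Finset (Fin m × Bool) | Y.card ≤ l}.ncard : ℕ) : ℝ)
  have hN : N ≤ (1024 / ε) ^ l * Real.exp (ε * m / 512) := by
    have h4 : (1024 / ε) ^ l * (ε / 1024) ^ l = 1 := by
      rw [← mul_pow]; field_simp; simp
    calc N = (1024 / ε) ^ l * ((ε / 1024) ^ l * N) := by rw [← mul_assoc, h4, one_mul]
      _ ≤ (1024 / ε) ^ l * (1 + ε / 1024) ^ Fintype.card (Fin m × Bool) := by gcongr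
      _ ≤ (1024 / ε) ^ l * (Real.exp (ε / 1024)) ^ Fintype.card (Fin m × Bool) := by
        gcongr
        have := Real.add_one_le_exp (ε / 1024); linarith
      _ = _ := by
        rw [← Real.exp_nat_mul]
        congr 2
        simp only [Fintype.card_prod, Fintype.card_fin, Fintype.card_bool]
        push_cast; ring
  have h34 : (3 / 4 : ℝ) ^ t ≤ Real.exp (-(ε * m / 256)) := by
    calc (3 / 4 : ℝ) ^ t ≤ Real.exp (-(1 / 4)) ^ t := by
          gcongr
          have := Real.add_one_le_exp (-(1 / 4 : ℝ)); linarith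
      _ = Real.exp (t * (-(1 / 4))) := by rw [← Real.exp_nat_mul]
      _ ≤ _ := Real.exp_le_exp.2 (by linarith)
  refine h1.trans ((mul_le_mul_right h2 2).trans ?_)
  have h5 : (2 : ℝ≥0∞) = ENNReal.ofReal 2 := by simp
  rw [h5, ← ENNReal.ofReal_mul (by norm_num)]
  refine ENNReal.ofReal_le_ofReal ?_
  calc 2 * (N * (2 ^ l * (3 / 4) ^ t))
      ≤ 2 * (((1024 / ε) ^ l * Real.exp (ε * m / 512)) *
          (2 ^ l * Real.exp (-(ε * m / 256)))) := by gcongr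
    _ = 2 * ((1024 / ε) ^ l * 2 ^ l) * (Real.exp (ε * m / 512) * Real.exp (-(ε * m / 256))) := by
        ring
    _ = _ := by
        rw [← mul_pow, ← Real.exp_add, show 1024 / ε * 2 = 2048 / ε by ring]
        congr 2
        ring

theorem measure_badSamples_le {X : Type u} [MeasurableSpace X] {H : Set (X → unitInterval)}
    (hH : ∀ h ∈ H, Measurable h) {γ ε δ : ℝ} {hs : X → unitInterval} {m d : ℕ} (D : Measure X)
    [IsProbabilityMeasure D] (hadm : Admissible H γ) (hhs : hs ∈ H) (hd : graphDim H γ ≤ d)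
    (hd1 : 1 ≤ d) (hε0 : 0 < ε) (hε1 : ε ≤ 1) (hδ0 : 0 < δ) (hδ1 : δ ≤ 1)
    (hm : Real.log 2 + 16 * d * Real.log (2048 / ε) + Real.log (1 / δ) ≤ ε * m / 512) :
    Measure.pi (fun _ : Fin m => D) (badSamples H D γ ε hs m) ≤ ENNReal.ofReal δ := by
  have hd1' : (1 : ℝ) ≤ d := by exact_mod_cast hd1
  have hlog2 : 1 / 2 ≤ Real.log 2 := by have := Real.log_two_gt_d9; linarith
  have hlogδ : 0 ≤ Real.log (1 / δ) := Real.log_nonneg (by rw [le_div_iff₀ hδ0]; linarith)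
  have h1ε : 1 ≤ 2048 / ε := by rw [le_div_iff₀ hε0]; linarith
  have hlogε : 0 ≤ Real.log (2048 / ε) := Real.log_nonneg h1ε
  have hpos : 0 ≤ 16 * d * Real.log (2048 / ε) := by positivity
  refine (measure_badSamples_le_exp hH D hadm hhs hd hε0 hε1 (by linarith)).trans
    (ENNReal.ofReal_le_ofReal ?_)
  have hb : (0 : ℝ) < 2048 / ε := by positivity
  calc 2 * (2048 / ε) ^ (8 * (d + 1)) * Real.exp (-(ε * m / 512))
      ≤ 2 * (2048 / ε) ^ (16 * d) * Real.exp (-(ε * m / 512)) := by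
        have := pow_le_pow_right₀ h1ε (show 8 * (d + 1) ≤ 16 * d by omega)
        gcongr 2 * ?_ * _
    _ = Real.exp (Real.log 2 + 16 * d * Real.log (2048 / ε) - ε * m / 512) := by
        rw [sub_eq_add_neg, Real.exp_add, Real.exp_add, Real.exp_log (by norm_num)]
        congr 2
        rw [← Real.rpow_natCast, Real.rpow_def_of_pos hb]
        congr 1; push_cast; ring
    _ ≤ Real.exp (-Real.log (1 / δ)) := Real.exp_le_exp.2 (by linarith)
    _ = δ := by rw [one_div, Real.log_inv, neg_neg, Real.exp_log hδ0]

theorem deviation_le_of_graphDim_eq_zero {X : Type u} {H : Set (X → unitInterval)} {γ : ℝ}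
    (h0 : graphDim H γ = 0) {h g : X → unitInterval} (hh : h ∈ H) (hg : g ∈ H) (x : X) :
    |(h x : ℝ) - (g x : ℝ)| ≤ γ := by
  by_contra! hcon
  have : GraphShattered H γ (fun _ : Fin 1 => x) := by
    refine ⟨fun _ => g x, fun b => ?_⟩
    cases hb : b 0
    · exact ⟨g, hg, fun i => by rw [Fin.fin_one_eq_zero i, hb]; simp⟩
    · exact ⟨h, hh, fun i => by rw [Fin.fin_one_eq_zero i, hb]; simpa using hcon⟩
  have := graphShattered_le_graphDim this
  rw [h0] at this
  simp at this

theorem cutoffLoss_eq_zero_of_graphDim_eq_zero {X : Type u} [MeasurableSpace X]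
    {H : Set (X → unitInterval)} {γ : ℝ} (h0 : graphDim H γ = 0) {h g : X → unitInterval}
    (hh : h ∈ H) (hg : g ∈ H) (D : Measure X) : cutoffLoss D γ h g = 0 := by
  have : {x | γ < |(h x : ℝ) - (g x : ℝ)|} = ∅ := by
    ext x; simpa using deviation_le_of_graphDim_eq_zero h0 hh hg x
  rw [cutoffLoss, this, measure_empty]

theorem abs_sub_unitInterval_le_one (a b : unitInterval) : |(a : ℝ) - (b : ℝ)| ≤ 1 := by
  rw [abs_le]
  constructor <;> linarith [a.2.1, a.2.2, b.2.1, b.2.2]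

theorem expectedLoss_le_add_cutoffLoss {X : Type u} [MeasurableSpace X] (D : Measure X)
    [IsProbabilityMeasure D] {h g : X → unitInterval} (hh : Measurable h) (hg : Measurable g)
    (γ : ℝ) : expectedLoss D h g ≤ ENNReal.ofReal γ + cutoffLoss D γ h g := by
  have hm := measurableSet_deviation hh hg γ
  calc expectedLoss D h g
      ≤ ∫⁻ x, (ENNReal.ofReal γ + {x | γ < |(h x : ℝ) - (g x : ℝ)|}.indicator 1 x) ∂D := by
        refine lintegral_mono fun x => ?_
        by_cases hx : γ < |(h x : ℝ) - (g x : ℝ)|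
        · have : x ∈ {x | γ < |(h x : ℝ) - (g x : ℝ)|} := hx
          rw [Set.indicator_of_mem this]
          refine le_add_left (ENNReal.ofReal_le_one.2 (abs_sub_unitInterval_le_one _ _))
        · exact le_add_right (ENNReal.ofReal_le_ofReal (not_lt.1 hx))
    _ = _ := by
        rw [lintegral_add_left measurable_const, lintegral_indicator_one hm]
        simp [cutoffLoss]

theorem mul_cutoffLoss_le_expectedLoss {X : Type u} [MeasurableSpace X] (D : Measure X)
    {h g : X → unitInterval} (hh : Measurable h) (hg : Measurable g)
    (γ : ℝ) : ENNReal.ofReal γ * cutoffLoss D γ h g ≤ expectedLoss D h g := by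
  have hm := measurableSet_deviation hh hg γ
  calc ENNReal.ofReal γ * cutoffLoss D γ h g
      = ∫⁻ x, {x | γ < |(h x : ℝ) - (g x : ℝ)|}.indicator (fun _ => ENNReal.ofReal γ) x ∂D := by
        rw [lintegral_indicator_const hm, cutoffLoss]
    _ ≤ _ := by
        refine lintegral_mono fun x => ?_
        by_cases hx : x ∈ {x | γ < |(h x : ℝ) - (g x : ℝ)|}
        · rw [Set.indicator_of_mem hx]
          exact ENNReal.ofReal_le_ofReal (le_of_lt hx)
        · rw [Set.indicator_of_notMem hx]
          exact bot_le

theorem IsERM.mem {X : Type u} {H : Set (X → unitInterval)} {A : Learner X} (hA : IsERM H A)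
    {hs : X → unitInterval} (hhs : hs ∈ H) {n : ℕ} (S : Fin n → X) :
    A n (labeled hs S) ∈ H ∧ ∀ i, A n (labeled hs S) (S i) = hs (S i) :=
  hA n (labeled hs S) ⟨hs, hhs, fun _ => rfl⟩

theorem CutoffPACGuarantee.pacGuarantee {X : Type u} [MeasurableSpace X]
    {H : Set (X → unitInterval)} (hH : ∀ h ∈ H, Measurable h) {A : Learner X} (hA : IsERM H A)
    {ε δ γ : ℝ} {m : ℕ} (hγ : 0 ≤ γ) (hε : 0 ≤ ε) (h : CutoffPACGuarantee H A ε δ γ m) :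
    PACGuarantee H A (γ + ε) δ m := by
  intro D _ hs hhs
  refine (measure_mono fun S hS => ?_).trans (h D hs hhs)
  have hS : ENNReal.ofReal (γ + ε) < expectedLoss D (A m (labeled hs S)) hs := hS
  rw [ENNReal.ofReal_add hγ hε] at hS
  exact (ENNReal.add_lt_add_iff_left ENNReal.ofReal_ne_top).1
    (hS.trans_le (expectedLoss_le_add_cutoffLoss D (hH _ (hA.mem hhs S).1) (hH _ hhs) γ))

theorem PACGuarantee.cutoffPACGuarantee {X : Type u} [MeasurableSpace X]
    {H : Set (X → unitInterval)} (hH : ∀ h ∈ H, Measurable h) {A : Learner X} (hA : IsERM H A)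
    {ε δ γ : ℝ} {m : ℕ} (hγ : 0 < γ) (h : PACGuarantee H A (γ * ε) δ m) :
    CutoffPACGuarantee H A ε δ γ m := by
  intro D _ hs hhs
  refine (measure_mono fun S hS => ?_).trans (h D hs hhs)
  have hS : ENNReal.ofReal ε < cutoffLoss D γ (A m (labeled hs S)) hs := hS
  refine lt_of_lt_of_le ?_
    (mul_cutoffLoss_le_expectedLoss D (hH _ (hA.mem hhs S).1) (hH _ hhs) γ)
  rw [ENNReal.ofReal_mul hγ.le]
  exact ENNReal.mul_lt_mul_right (ENNReal.ofReal_pos.2 hγ).ne' ENNReal.ofReal_ne_top hS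

theorem ermSampleComplexity_le_cutoff {X : Type u} [MeasurableSpace X]
    {H : Set (X → unitInterval)} (hH : ∀ h ∈ H, Measurable h) {ε δ γ : ℝ} (hγ : 0 ≤ γ)
    (hε : 0 ≤ ε) : ermSampleComplexity H (γ + ε) δ ≤ ermCutoffSampleComplexity H ε δ γ :=
  iSup₂_mono fun _ hA => iInf_mono fun _ =>
    iInf_mono' fun h => ⟨fun m hm => (h m hm).pacGuarantee hH hA hγ hε, le_rfl⟩

theorem ermCutoffSampleComplexity_le {X : Type u} [MeasurableSpace X]
    {H : Set (X → unitInterval)} (hH : ∀ h ∈ H, Measurable h) {ε δ γ : ℝ} (hγ : 0 < γ) :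
    ermCutoffSampleComplexity H ε δ γ ≤ ermSampleComplexity H (γ * ε) δ :=
  iSup₂_mono fun _ hA => iInf_mono fun _ =>
    iInf_mono' fun h => ⟨fun m hm => (h m hm).cutoffPACGuarantee hH hA hγ, le_rfl⟩

theorem ermCutoffSampleComplexity_le_of_badSamples {X : Type u} [MeasurableSpace X]
    {H : Set (X → unitInterval)} {ε δ γ : ℝ} {M : ℕ}
    (h : ∀ m ≥ M, ∀ (D : Measure X) [IsProbabilityMeasure D], ∀ hs ∈ H,
      Measure.pi (fun _ : Fin m => D) (badSamples H D γ ε hs m) ≤ ENNReal.ofReal δ) :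
    ermCutoffSampleComplexity H ε δ γ ≤ M := by
  refine iSup₂_le fun A hA => iInf₂_le M ?_
  intro m hm D _ hs hhs
  refine (measure_mono fun S hS => ?_).trans (h m hm D hs hhs)
  exact ⟨_, (hA.mem hhs S).1, (hA.mem hhs S).2, hS⟩

/-- The upper bound of order `(d log (1 / ε) + log (1 / δ)) / ε` on the cut-off sample complexity of
the worst ERM. At dimension `0` every ERM has cut-off loss zero, which spares the term
`log (1 / ε)` there. -/
theorem exists_ermCutoffSampleComplexity_le {η : ℝ} (hη : η ∈ Ioo (0 : ℝ) 1) :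
    ∃ C : ℝ, 0 < C ∧ ∀ (X : Type u) [MeasurableSpace X] (H : Set (X → unitInterval)),
      (∀ h ∈ H, Measurable h) → ∀ γ, ∀ ε ∈ Ioc (0 : ℝ) η, ∀ δ ∈ Ioc (0 : ℝ) η,
        Admissible H γ →
          (ermCutoffSampleComplexity H ε δ γ : ℝ≥0∞) ≤
            ENNReal.ofReal C *
              (((graphDim H γ : ℝ≥0∞) * ENNReal.ofReal (Real.log (1 / ε)) +
                ENNReal.ofReal (Real.log (1 / δ))) / ENNReal.ofReal ε) := by
  set a := Real.log (1 / η) with ha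
  have ha0 : 0 < a := Real.log_pos (by rw [lt_div_iff₀ hη.1]; linarith [hη.2])
  set b := Real.log 2048 with hb
  have hb0 : 0 < b := Real.log_pos (by norm_num)
  have hlog2 : 1 / 2 ≤ Real.log 2 := by have := Real.log_two_gt_d9; linarith
  set A := Real.log 2 / a + 16 * (1 + b / a) + 1 with hA
  have hA0 : 0 < A := by positivity
  refine ⟨1024 * A, by positivity, fun X _ H hH γ ε hε δ hδ hadm => ?_⟩
  have hlog : ∀ x ∈ Ioc (0 : ℝ) η, a ≤ Real.log (1 / x) := fun x hx =>
    Real.log_le_log (by have := hη.1; positivity) (one_div_le_one_div_of_le hx.1 hx.2)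
  have hε' := hlog ε hε
  have hδ' := hlog δ hδ
  have hε1 : ε ≤ 1 := hε.2.trans hη.2.le
  have hδ1 : δ ≤ 1 := hδ.2.trans hη.2.le
  rcases eq_or_ne (graphDim H γ) ⊤ with htop | htop
  · have hεt : ENNReal.ofReal (Real.log (1 / ε)) ≠ 0 := (ENNReal.ofReal_pos.2 (by linarith)).ne'
    have hC : ENNReal.ofReal (1024 * A) ≠ 0 := (ENNReal.ofReal_pos.2 (by positivity)).ne'
    rw [htop, ENat.toENNReal_top, ENNReal.top_mul hεt, top_add,
      ENNReal.top_div_of_ne_top ENNReal.ofReal_ne_top, ENNReal.mul_top hC]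
    exact le_top
  obtain ⟨d, hd⟩ := ENat.ne_top_iff_exists.1 htop
  rcases Nat.eq_zero_or_pos d with rfl | hdpos
  · have h0 : graphDim H γ = 0 := by rw [← hd]; rfl
    have : ermCutoffSampleComplexity H ε δ γ ≤ (0 : ℕ) := by
      refine ermCutoffSampleComplexity_le_of_badSamples fun m _ D _ hs hhs => ?_
      have hemp : badSamples H D γ ε hs m = ∅ := by
        ext S
        simp only [badSamples, Set.mem_ofPred_eq, Set.mem_empty_iff_false, iff_false]
        rintro ⟨h, hh, _, hl⟩
        rw [cutoffLoss_eq_zero_of_graphDim_eq_zero h0 hh hhs] at hl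
        exact not_lt_bot hl
      rw [hemp, measure_empty]
      exact bot_le
    have h0' : ermCutoffSampleComplexity H ε δ γ = 0 := by simpa using this
    rw [h0']
    simp
  have hd1 : (1 : ℝ) ≤ d := by exact_mod_cast hdpos
  set Q := d * Real.log (1 / ε) + Real.log (1 / δ) with hQ
  have hdε : 0 ≤ d * Real.log (1 / ε) := mul_nonneg (by linarith) (by linarith)
  have hQa : a ≤ Q := by linarith
  set B := 512 * A * Q / ε with hB
  -- `1 ≤ B` lets the rounding of `B` be absorbed by a factor `2`
  have hB1 : 1 ≤ B := by
    rw [hB, le_div_iff₀ hε.1]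
    have h1 : Real.log 2 ≤ A * a := by
      rw [hA]
      have : Real.log 2 / a * a = Real.log 2 := by field_simp
      have h2 : 0 ≤ (16 * (1 + b / a) + 1) * a := by positivity
      linarith
    have h2 : A * a ≤ A * Q := by gcongr
    linarith
  have hM : ermCutoffSampleComplexity H ε δ γ ≤ (⌈B⌉₊ : ℕ) := by
    refine ermCutoffSampleComplexity_le_of_badSamples fun m hm D _ hs hhs => ?_
    have hm : B ≤ m := (Nat.le_ceil B).trans (by exact_mod_cast hm)
    refine measure_badSamples_le hH D hadm hhs hd.ge hdpos hε.1 hε1 hδ.1 hδ1 ?_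
    have h1 : 512 * A * Q ≤ m * ε := (div_le_iff₀ hε.1).1 hm
    have h2 : Real.log (2048 / ε) = b + Real.log (1 / ε) := by
      rw [hb, ← Real.log_mul (by norm_num) (by have := hε.1; positivity)]; congr 1; ring
    have h3 : b ≤ b / a * Real.log (1 / ε) := by
      calc b = b / a * a := by field_simp
        _ ≤ _ := by gcongr
    have h4 : Real.log 2 ≤ Real.log 2 / a * Q := by
      calc Real.log 2 = Real.log 2 / a * a := by field_simp
        _ ≤ _ := by gcongr
    have h5 : 16 * d * Real.log (2048 / ε) ≤ 16 * (1 + b / a) * Q := by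
      calc 16 * d * Real.log (2048 / ε)
          ≤ 16 * d * (b / a * Real.log (1 / ε) + Real.log (1 / ε)) := by rw [h2]; gcongr
        _ = 16 * (1 + b / a) * (d * Real.log (1 / ε)) := by ring
        _ ≤ _ := by gcongr; linarith
    have h6 : A * Q = Real.log 2 / a * Q + 16 * (1 + b / a) * Q + Q := by rw [hA]; ring
    linarith
  have hle : ((⌈B⌉₊ : ℕ) : ℝ) ≤ 1024 * A * (Q / ε) := by
    have := Nat.ceil_lt_add_one (show 0 ≤ B by linarith)
    have h2 : 1024 * A * (Q / ε) = 2 * B := by rw [hB]; ring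
    linarith
  calc (ermCutoffSampleComplexity H ε δ γ : ℝ≥0∞) ≤ (((⌈B⌉₊ : ℕ) : ℕ∞) : ℝ≥0∞) :=
        ENat.toENNReal_le.2 hM
    _ = ENNReal.ofReal ((⌈B⌉₊ : ℕ) : ℝ) := by simp
    _ ≤ ENNReal.ofReal (1024 * A * (Q / ε)) := ENNReal.ofReal_le_ofReal hle
    _ = _ := by
      rw [ENNReal.ofReal_mul (by positivity), ENNReal.ofReal_div_of_pos hε.1, hQ,
        ENNReal.ofReal_add hdε (by linarith), ENNReal.ofReal_mul (p := (d : ℝ)) (by linarith), ← hd]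
      simp

/-! ### Samples on which an ERM fails -/

/-- An ERM may return any prescribed consistent members of `H` on the samples labelled by one
prescribed target for each sample size. -/
theorem exists_erm {X : Type u} {H : Set (X → unitInterval)}
    (hs : ℕ → X → unitInterval)
    (G : (n : ℕ) → (Fin n → X) → X → unitInterval)
    (hG : ∀ n S, G n S ∈ H ∧ ∀ i, G n S (S i) = hs n (S i)) :
    ∃ A : Learner X, IsERM H A ∧ ∀ n S, A n (labeled (hs n) S) = G n S := by
  classical
  refine ⟨fun n T => if T = labeled (hs n) (fun i => (T i).1) then G n (fun i => (T i).1)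
    else if h : ∃ h ∈ H, ∀ i, h (T i).1 = (T i).2 then h.choose else fun _ => 0, ?_, ?_⟩
  · intro n T hT
    dsimp only
    split_ifs with h1
    · refine ⟨(hG n _).1, fun i => ?_⟩
      rw [(hG n _).2 i]
      exact (congrArg Prod.snd (congrFun h1 i)).symm
    · exact hT.choose_spec
  · intro n S
    exact if_pos rfl

/-- For any choice of a distribution and a target for each sample size, one ERM fails on all bad
samples of all sizes. -/
theorem exists_erm_forall_badSamples {X : Type u} [MeasurableSpace X]
    {H : Set (X → unitInterval)} (γ ε : ℝ) (D : ℕ → Measure X) (hs : ℕ → X → unitInterval)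
    (hhs : ∀ n, hs n ∈ H) :
    ∃ A : Learner X, IsERM H A ∧ ∀ n, ∀ S ∈ badSamples H (D n) γ ε (hs n) n,
      ENNReal.ofReal ε < cutoffLoss (D n) γ (A n (labeled (hs n) S)) (hs n) := by
  classical
  obtain ⟨A, hA, hAG⟩ := exists_erm hs
    (fun n S => if h : S ∈ badSamples H (D n) γ ε (hs n) n then h.choose else hs n) (by
      intro n S
      split_ifs with h
      · exact ⟨h.choose_spec.1, h.choose_spec.2.1⟩
      · exact ⟨hhs n, fun _ => rfl⟩)
  refine ⟨A, hA, fun n S hS => ?_⟩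
  rw [hAG, dif_pos hS]
  exact hS.choose_spec.2.2

theorem lt_ermCutoffSampleComplexity {X : Type u} [MeasurableSpace X]
    {H : Set (X → unitInterval)} {γ ε δ : ℝ} {m : ℕ} (D : Measure X) [IsProbabilityMeasure D]
    {hs : X → unitInterval} (hhs : hs ∈ H)
    (h : ENNReal.ofReal δ < Measure.pi (fun _ : Fin m => D) (badSamples H D γ ε hs m)) :
    (m : ℕ∞) < ermCutoffSampleComplexity H ε δ γ := by
  obtain ⟨A, hA, hbad⟩ := exists_erm_forall_badSamples (H := H) γ ε (fun _ => D) (fun _ => hs)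
    (fun _ => hhs)
  have hlt : (m : ℕ∞) + 1 ≤ cutoffSampleComplexity H A ε δ γ := by
    refine le_iInf₂ fun M hM => ?_
    have : m < M := by
      by_contra hcon
      exact absurd (hM m (not_lt.1 hcon) D hs hhs)
        (not_le.2 (h.trans_le (measure_mono fun S hS => hbad m S hS)))
    exact_mod_cast this
  have h2 : (m : ℕ∞) < m + 1 := by exact_mod_cast Nat.lt_succ_self m
  exact h2.trans_le (hlt.trans (le_iSup₂ (f := fun (A : Learner X) (_ : IsERM H A) =>
    cutoffSampleComplexity H A ε δ γ) A hA))

/-- With mass `q > ε` at the point where `h` and `g` differ, a sample misses that point with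
probability `(1 - q) ^ m`, and then `h` is consistent with the target `g`. -/
theorem Nondegenerate.exists_lt_measure_badSamples {X : Type u} [MeasurableSpace X]
    {H : Set (X → unitInterval)} (hH : ∀ h ∈ H, Measurable h) {γ ε δ q : ℝ}
    (hnd : Nondegenerate H γ) (hε : 0 < ε) (hq : ε < q) (hq1 : q < 1) (hδ : 0 < δ) {m : ℕ}
    (hm : m * (q / (1 - q)) < Real.log (1 / δ)) :
    ∃ D : Measure X, IsProbabilityMeasure D ∧ ∃ hs ∈ H,
      ENNReal.ofReal δ < Measure.pi (fun _ : Fin m => D) (badSamples H D γ ε hs m) := by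
  obtain ⟨h, hh, g, hg, x, y, hx, hy⟩ := hnd
  let D : Measure X := ENNReal.ofReal (1 - q) • Measure.dirac x + ENNReal.ofReal q • Measure.dirac y
  have hD : IsProbabilityMeasure D := ⟨by
    simp only [D, Measure.add_apply, Measure.smul_apply, measure_univ, smul_eq_mul, mul_one]
    rw [← ENNReal.ofReal_add (by linarith) (by linarith)]
    simp⟩
  refine ⟨D, hD, g, hg, ?_⟩
  set V : Set X := {z | h z = g z} with hV
  have hVm : MeasurableSet V := measurableSet_eq_fun (hH h hh) (hH g hg)
  have hDV : ENNReal.ofReal (1 - q) ≤ D V := by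
    simp only [D, Measure.add_apply, Measure.smul_apply, smul_eq_mul]
    rw [Measure.dirac_apply' _ hVm, Set.indicator_of_mem (show x ∈ V from hx)]
    simp
  have hDW : ENNReal.ofReal ε < cutoffLoss D γ h g := by
    have hW := measurableSet_deviation (hH h hh) (hH g hg) γ
    simp only [cutoffLoss, D, Measure.add_apply, Measure.smul_apply, smul_eq_mul]
    rw [Measure.dirac_apply' y hW, Set.indicator_of_mem (show y ∈ {x | γ < |(h x : ℝ) - (g x : ℝ)|} from hy)]
    refine lt_of_lt_of_le ((ENNReal.ofReal_lt_ofReal_iff (by linarith)).2 hq) ?_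
    simp
  have hδm : δ < (1 - q) ^ m := by
    have h1 := Real.one_sub_inv_le_log_of_pos (show 0 < 1 - q by linarith)
    have h2 : 1 - (1 - q)⁻¹ = -(q / (1 - q)) := by
      have : (1 - q) ≠ 0 := by linarith
      field_simp; ring
    rw [h2] at h1
    rw [one_div, Real.log_inv] at hm
    have h3 : Real.log δ < m * Real.log (1 - q) := by
      have := mul_le_mul_of_nonneg_left h1 (Nat.cast_nonneg (α := ℝ) m)
      linarith
    rw [← Real.log_pow] at h3
    exact (Real.log_lt_log_iff hδ (pow_pos (by linarith) m)).1 h3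
  calc ENNReal.ofReal δ < ENNReal.ofReal ((1 - q) ^ m) :=
        (ENNReal.ofReal_lt_ofReal_iff (pow_pos (by linarith) m)).2 hδm
    _ = ENNReal.ofReal (1 - q) ^ m := ENNReal.ofReal_pow (by linarith) m
    _ ≤ D V ^ m := by gcongr
    _ = Measure.pi (fun _ : Fin m => D) (Set.univ.pi fun _ => V) := by
        rw [Measure.pi_pi]; simp
    _ ≤ _ := measure_mono (fun S hS => by exact ⟨h, hh, fun i => hS i trivial, hDW⟩)

/-- The distribution on `k + 1` points with mass `1 - q` at `0` and mass `q / k` at each of the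
other points. -/
noncomputable def heavyPoint (k : ℕ) (q : ℝ) : Measure (Fin (k + 1)) :=
  ENNReal.ofReal (1 - q) • Measure.dirac 0 +
    ∑ i : Fin k, ENNReal.ofReal (q / k) • Measure.dirac i.succ

theorem heavyPoint_apply (k : ℕ) (q : ℝ) (s : Set (Fin (k + 1))) :
    heavyPoint k q s = ENNReal.ofReal (1 - q) * s.indicator 1 0 +
      ∑ i : Fin k, ENNReal.ofReal (q / k) * s.indicator 1 i.succ := by
  simp [heavyPoint]

theorem natCast_mul_ofReal_div {k : ℕ} (hk : 0 < k) (q : ℝ) :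
    (k : ℝ≥0∞) * ENNReal.ofReal (q / k) = ENNReal.ofReal q := by
  have hk0 : (0 : ℝ) < k := by exact_mod_cast hk
  rw [← ENNReal.ofReal_natCast, ← ENNReal.ofReal_mul hk0.le]
  congr 1; field_simp

theorem isProbabilityMeasure_heavyPoint {k : ℕ} (hk : 0 < k) {q : ℝ} (hq0 : 0 ≤ q) (hq1 : q ≤ 1) :
    IsProbabilityMeasure (heavyPoint k q) := ⟨by
  rw [heavyPoint_apply]
  simp only [Set.indicator_univ, Pi.one_apply, mul_one, Finset.sum_const, Finset.card_univ,
    Fintype.card_fin, nsmul_eq_mul]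
  rw [natCast_mul_ofReal_div hk, ← ENNReal.ofReal_add (by linarith) hq0]
  simp⟩

theorem heavyPoint_ne_zero {k : ℕ} (hk : 0 < k) (q : ℝ) :
    heavyPoint k q {i | i ≠ 0} = ENNReal.ofReal q := by
  rw [heavyPoint_apply]
  simp [natCast_mul_ofReal_div hk]

/-- Markov's inequality for the number of sample points off the heavy point. -/
theorem lt_measure_card_lt_heavyPoint {k m : ℕ} (hk : 0 < k) {q δ a : ℝ} (hq0 : 0 ≤ q)
    (hq1 : q ≤ 1) (hδ : 0 < δ) (ha : 0 < a) (hm : m * q < (1 - δ) * a) :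
    ENNReal.ofReal δ < Measure.pi (fun _ : Fin m => heavyPoint k q)
      {s | ((Finset.univ.filter fun j => s j ≠ 0).card : ℝ) < a} := by
  have := isProbabilityMeasure_heavyPoint hk hq0 hq1
  set μ := Measure.pi fun _ : Fin m => heavyPoint k q with hμ
  let N : (Fin m → Fin (k + 1)) → ℝ≥0∞ := fun s => ∑ j, ({i | i ≠ 0} : Set _).indicator 1 (s j)
  have hNc : ∀ s, N s = ENNReal.ofReal ((Finset.univ.filter fun j => s j ≠ 0).card : ℝ) := by
    intro s
    rw [ENNReal.ofReal_natCast]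
    simp [N, Set.indicator_apply, Finset.card_filter]
  have hNint : ∫⁻ s, N s ∂μ = m * ENNReal.ofReal q := by
    rw [lintegral_finsetSum _ fun j _ => measurable_of_finite _]
    have : ∀ j : Fin m, ∫⁻ s, ({i | i ≠ 0} : Set (Fin (k + 1))).indicator 1 (s j) ∂μ
        = ENNReal.ofReal q := by
      intro j
      have h := (measurePreserving_eval (fun _ : Fin m => heavyPoint k q) j).lintegral_comp
        (f := ({i | i ≠ 0} : Set (Fin (k + 1))).indicator 1) (measurable_of_finite _)
      rw [lintegral_indicator_one (Set.toFinite _).measurableSet, heavyPoint_ne_zero hk] at h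
      exact h
    simp [this]
  have hmarkov := mul_meas_ge_le_lintegral (μ := μ) (measurable_of_finite N) (ENNReal.ofReal a)
  rw [hNint] at hmarkov
  have h0 : 0 ≤ m * q := by positivity
  have hδ1 : 0 < 1 - δ := by
    by_contra hcon
    have : (1 - δ) * a ≤ 0 := mul_nonpos_of_nonpos_of_nonneg (not_lt.1 hcon) ha.le
    linarith
  have hmark : μ {s | ENNReal.ofReal a ≤ N s} < ENNReal.ofReal (1 - δ) := by
    have h1 : ENNReal.ofReal a * μ {s | ENNReal.ofReal a ≤ N s}
        < ENNReal.ofReal a * ENNReal.ofReal (1 - δ) := by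
      refine hmarkov.trans_lt ?_
      rw [← ENNReal.ofReal_natCast, ← ENNReal.ofReal_mul (by positivity),
        ← ENNReal.ofReal_mul ha.le]
      exact (ENNReal.ofReal_lt_ofReal_iff (by positivity)).2 (by linarith)
    exact lt_of_mul_lt_mul_left' h1
  by_contra hcon
  have h1 : (1 : ℝ≥0∞) ≤ μ {s | ((Finset.univ.filter fun j => s j ≠ 0).card : ℝ) < a}
      + μ {s | ENNReal.ofReal a ≤ N s} := by
    rw [← measure_univ (μ := μ)]
    refine (measure_mono fun s _ => ?_).trans (measure_union_le _ _)
    refine (lt_or_ge _ a).imp id fun h => ?_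
    change ENNReal.ofReal a ≤ N s
    rw [hNc]
    exact ENNReal.ofReal_le_ofReal h
  have h2 := ENNReal.add_lt_add_of_le_of_lt (measure_ne_top _ _) (not_lt.1 hcon) hmark
  rw [← ENNReal.ofReal_add hδ.le hδ1.le] at h2
  simp only [add_sub_cancel, ENNReal.ofReal_one] at h2
  exact absurd h1 (not_le.2 h2)

/-- A hypothesis deviating at all unsampled light points has large loss. -/
theorem ofReal_lt_heavyPoint_of_unsampled {k m : ℕ} (hk : 0 < k) {q ε : ℝ} (hε : 0 < ε)
    (hq : ε < q) {s : Fin m → Fin (k + 1)}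
    (hs : ((Finset.univ.filter fun j => s j ≠ 0).card : ℝ) < (1 - ε / q) * k)
    {W : Set (Fin (k + 1))} (hW : ∀ i : Fin k, (∀ j, s j ≠ i.succ) → i.succ ∈ W) :
    ENNReal.ofReal ε < heavyPoint k q W := by
  classical
  have hk0 : (0 : ℝ) < k := by exact_mod_cast hk
  have hq0 : 0 < q := hε.trans hq
  set U : Finset (Fin k) := Finset.univ.filter fun i => ∃ j, s j = i.succ with hU
  have hUN : U.card ≤ (Finset.univ.filter fun j => s j ≠ 0).card := by
    have : U.map (Fin.succEmb k) ⊆ (Finset.univ.filter fun j => s j ≠ 0).image s := by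
      intro i hi
      obtain ⟨i', hi', rfl⟩ := Finset.mem_map.1 hi
      obtain ⟨j, hj⟩ := (Finset.mem_filter.1 hi').2
      refine Finset.mem_image.2 ⟨j, ?_, hj⟩
      simp [hj]
    rw [← Finset.card_map (Fin.succEmb k)]
    exact (Finset.card_le_card this).trans Finset.card_image_le
  have hUN' : (U.card : ℝ) ≤ (Finset.univ.filter fun j => s j ≠ 0).card := by exact_mod_cast hUN
  have hUc : (Uᶜ.card : ℝ) = k - U.card := by
    rw [Finset.card_compl, Fintype.card_fin, Nat.cast_sub]
    exact (Finset.card_le_univ U).trans (by simp)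
  have h2 : ε / q * k < Uᶜ.card := by rw [hUc]; linarith
  have h3 : ε < Uᶜ.card * (q / k) := by
    calc ε = (ε / q * k) * (q / k) := by field_simp
      _ < _ := mul_lt_mul_of_pos_right h2 (by positivity)
  rw [heavyPoint_apply]
  calc ENNReal.ofReal ε < ENNReal.ofReal (Uᶜ.card * (q / k)) :=
        (ENNReal.ofReal_lt_ofReal_iff (hε.trans h3)).2 h3
    _ = ∑ i ∈ Uᶜ, ENNReal.ofReal (q / k) := by
        rw [ENNReal.ofReal_mul (by positivity)]; simp
    _ ≤ ∑ i ∈ Uᶜ, ENNReal.ofReal (q / k) * W.indicator 1 i.succ := by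
        refine Finset.sum_le_sum fun i hi => ?_
        rw [Set.indicator_of_mem (hW i (by simpa [hU] using hi))]
        simp
    _ ≤ ∑ i : Fin k, ENNReal.ofReal (q / k) * W.indicator 1 i.succ :=
        Finset.sum_le_sum_of_subset (Finset.subset_univ _)
    _ ≤ _ := le_add_self

/-- A shattered sample of size `k + 1` makes an ERM fail at sample sizes up to a constant times
`k / ε`: under `heavyPoint k q`, transported to the shattered points, most light points are
unsampled, and shattering gives a hypothesis that deviates from the target exactly there. Pulling
back to `Fin (k + 1)` avoids any measurability of the points of `X`. -/
theorem GraphShattered.exists_lt_measure_badSamples {X : Type u} [MeasurableSpace X]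
    {H : Set (X → unitInterval)} (hH : ∀ h ∈ H, Measurable h) {γ ε δ q : ℝ} {k : ℕ}
    {S : Fin (k + 1) → X} (hsh : GraphShattered H γ S) (hk : 0 < k) (hε : 0 < ε) (hq : ε < q)
    (hq1 : q ≤ 1) (hδ : 0 < δ) {m : ℕ}
    (hm : m * q < (1 - δ) * ((1 - ε / q) * k)) :
    ∃ D : Measure X, IsProbabilityMeasure D ∧ ∃ hs ∈ H,
      ENNReal.ofReal δ < Measure.pi (fun _ : Fin m => D) (badSamples H D γ ε hs m) := by
  classical
  obtain ⟨f, hf⟩ := hsh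
  have hk0 : (0 : ℝ) < k := by exact_mod_cast hk
  have hq0 : 0 < q := hε.trans hq
  have hP := isProbabilityMeasure_heavyPoint hk hq0.le hq1
  have hSm : Measurable S := measurable_of_finite S
  have hD : IsProbabilityMeasure ((heavyPoint k q).map S) :=
    Measure.isProbabilityMeasure_map hSm.aemeasurable
  obtain ⟨hs, hhs, hhsf⟩ := hf fun _ => false
  refine ⟨_, hD, hs, hhs, ?_⟩
  have hpi : Measure.pi (fun _ : Fin m => (heavyPoint k q).map S) =
      (Measure.pi fun _ : Fin m => heavyPoint k q).map fun s j => S (s j) :=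
    (Measure.pi_map_pi fun _ => hSm.aemeasurable).symm
  have hεq : ε / q < 1 := (div_lt_one hq0).2 hq
  rw [hpi]
  refine (lt_measure_card_lt_heavyPoint hk hq0.le hq1 hδ (mul_pos (by linarith) hk0) hm).trans_le
    (le_trans (measure_mono fun s hs' => ?_)
      (Measure.le_map_apply (measurable_of_finite _).aemeasurable _))
  -- the hypothesis that agrees with the target exactly on the sampled points
  obtain ⟨h, hh, hhf⟩ := hf fun i => decide (∀ j, s j ≠ i)
  refine ⟨h, hh, fun j => ?_, ?_⟩
  · rw [(hhsf (s j)).1 rfl]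
    exact (hhf (s j)).1 (by simp)
  rw [cutoffLoss, Measure.map_apply hSm (measurableSet_deviation (hH h hh) (hH hs hhs) γ)]
  refine ofReal_lt_heavyPoint_of_unsampled hk hε hq hs' fun i hi => ?_
  change γ < |(h (S i.succ) : ℝ) - (hs (S i.succ) : ℝ)|
  rw [(hhsf i.succ).1 rfl]
  exact (hhf i.succ).2 (by simpa using hi)

/-! ### The graph dimension as a function of the scale -/

theorem GraphShattered.comp {X : Type u} {H : Set (X → unitInterval)} {γ : ℝ} {n k : ℕ}
    {S : Fin n → X} (h : GraphShattered H γ S) {e : Fin k → Fin n} (he : Function.Injective e) :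
    GraphShattered H γ (S ∘ e) := by
  obtain ⟨f, hf⟩ := h
  refine ⟨f ∘ e, fun b => ?_⟩
  obtain ⟨h, hh, hhf⟩ := hf (Function.extend e b fun _ => false)
  refine ⟨h, hh, fun i => ?_⟩
  have := hhf (e i)
  rwa [he.extend_apply] at this

theorem GraphShattered.anti {X : Type u} {H : Set (X → unitInterval)} {γ γ' : ℝ} {n : ℕ}
    {S : Fin n → X} (h : GraphShattered H γ' S) (hγ : γ ≤ γ') : GraphShattered H γ S := by
  obtain ⟨f, hf⟩ := h
  refine ⟨f, fun b => ?_⟩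
  obtain ⟨h, hh, hhf⟩ := hf b
  exact ⟨h, hh, fun i => ⟨(hhf i).1, fun hb => hγ.trans_lt ((hhf i).2 hb)⟩⟩

theorem exists_graphShattered {X : Type u} {H : Set (X → unitInterval)} {γ : ℝ} {d : ℕ}
    (hd0 : 0 < d) (hd : (d : ℕ∞) ≤ graphDim H γ) : ∃ S : Fin d → X, GraphShattered H γ S := by
  by_contra! hcon
  have : graphDim H γ ≤ ((d - 1 : ℕ) : ℕ∞) := by
    refine iSup₂_le fun n ⟨S, hS⟩ => ?_
    have : n < d := by
      by_contra hnd
      exact hcon _ (hS.comp (Fin.castLE_injective (not_lt.1 hnd)))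
    exact_mod_cast Nat.le_sub_one_of_lt this
  have := hd.trans this
  rw [Nat.cast_le] at this
  omega

/-- Shattering is an open condition in the scale: it consists of finitely many strict
inequalities. -/
theorem GraphShattered.exists_gt {X : Type u} {H : Set (X → unitInterval)} {γ : ℝ} {n : ℕ}
    {S : Fin n → X} (h : GraphShattered H γ S) : ∃ γ' > γ, GraphShattered H γ' S := by
  obtain ⟨f, hf⟩ := h
  choose g hg hgf using hf
  have hev : ∀ᶠ γ' in nhdsWithin γ (Ioi γ), ∀ b : Fin n → Bool, ∀ i, b i = true →
      γ' < |(g b (S i) : ℝ) - (f i : ℝ)| := by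
    refine Filter.eventually_all.2 fun b => Filter.eventually_all.2 fun i => ?_
    by_cases hb : b i = true
    · have := (hgf b i).2 hb
      filter_upwards [nhdsWithin_le_nhds (Iio_mem_nhds this)] with x hx _ using hx
    · exact Filter.Eventually.of_forall fun _ h => absurd h hb
  obtain ⟨γ', hγ', hlt⟩ := (hev.and self_mem_nhdsWithin).exists
  exact ⟨γ', hlt, f, fun b => ⟨g b, hg b, fun i => ⟨(hgf b i).1, hγ' b i⟩⟩⟩

/-- There is a least scale in `[0, 1]` at which the graph dimension is at most `d`. This reduces the
risk bound for all scales at once to one scale for each dimension. -/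
theorem exists_isLeast_graphDim_le {X : Type u} {H : Set (X → unitInterval)} {d : ℕ}
    (hne : {γ ∈ Icc (0 : ℝ) 1 | graphDim H γ ≤ d}.Nonempty) :
    ∃ γ, IsLeast {γ ∈ Icc (0 : ℝ) 1 | graphDim H γ ≤ d} γ := by
  set s := {γ ∈ Icc (0 : ℝ) 1 | graphDim H γ ≤ d} with hs
  have hbdd : BddBelow s := ⟨0, fun γ hγ => hγ.1.1⟩
  refine ⟨sInf s, ⟨⟨le_csInf hne fun γ hγ => hγ.1.1, ?_⟩, ?_⟩, fun γ hγ => csInf_le hbdd hγ⟩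
  · obtain ⟨γ, hγ⟩ := hne
    exact (csInf_le hbdd hγ).trans hγ.1.2
  · refine iSup₂_le fun n ⟨S, hS⟩ => ?_
    obtain ⟨γ', hγ', hS'⟩ := hS.exists_gt
    obtain ⟨γ, hγ, hlt⟩ := exists_lt_of_csInf_lt hne hγ'
    exact (graphShattered_le_graphDim (hS'.anti hlt.le)).trans hγ.2

/-! ### Lower bound on the sample complexity -/

/-- The lower bound of order `(d + log (1 / δ)) / ε` on the cut-off sample complexity of the worst
ERM. The term `log (1 / δ)` comes from nondegeneracy and the term `d` from a shattered sample; for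
`d ≤ 1` the former term absorbs the latter since `log (1 / δ) ≥ log (1 / η)`. -/
theorem exists_le_ermCutoffSampleComplexity {η : ℝ} (hη : η ∈ Ioo (0 : ℝ) 1) :
    ∃ c : ℝ, 0 < c ∧ ∀ (X : Type u) [MeasurableSpace X] (H : Set (X → unitInterval)),
      (∀ h ∈ H, Measurable h) → ∀ γ, ∀ ε ∈ Ioc (0 : ℝ) η, ∀ δ ∈ Ioc (0 : ℝ) η,
        Nondegenerate H γ →
          ENNReal.ofReal c *
              (((graphDim H γ : ℝ≥0∞) + ENNReal.ofReal (Real.log (1 / δ))) / ENNReal.ofReal ε)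
            ≤ (ermCutoffSampleComplexity H ε δ γ : ℝ≥0∞) := by
  obtain ⟨hη0, hη1⟩ := hη
  have h1η : 0 < 1 - η := by linarith
  set a := Real.log (1 / η) with ha
  have ha0 : 0 < a := Real.log_pos (by rw [lt_div_iff₀ hη0]; linarith)
  set a1 := (1 + η) / (η * (1 - η)) with ha1
  set a2 := (1 + η) ^ 2 / (η * (1 - η) ^ 2) with ha2
  have ha1' : 0 < a1 := by positivity
  have ha2' : 0 < a2 := by positivity
  set A := a1 + a2 + a1 / a with hA
  have hA0 : 0 < A := by positivity
  refine ⟨1 / A, by positivity, fun X _ H hH γ ε hε δ hδ hnd => ?_⟩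
  obtain ⟨hε0, hεη⟩ := hε
  obtain ⟨hδ0, hδη⟩ := hδ
  set L := Real.log (1 / δ) with hL
  have haL : a ≤ L := Real.log_le_log (by positivity) (one_div_le_one_div_of_le hδ0 hδη)
  rcases eq_or_ne (ermCutoffSampleComplexity H ε δ γ) ⊤ with htop | htop
  · rw [htop]; exact le_top
  obtain ⟨M, hM⟩ := ENat.ne_top_iff_exists.1 htop
  -- `q` exceeds `ε` by a constant factor and stays away from `1`
  set q := ε * ((1 + η) / (2 * η)) with hq
  have hqε : ε < q := by
    have : 1 < (1 + η) / (2 * η) := by rw [lt_div_iff₀ (by positivity)]; linarith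
    exact lt_mul_of_one_lt_right hε0 this
  have hq0 : 0 < q := hε0.trans hqε
  have hqη : q ≤ (1 + η) / 2 := by
    calc q ≤ η * ((1 + η) / (2 * η)) := by rw [hq]; gcongr
      _ = _ := by field_simp
  have hq1 : q < 1 := by linarith
  have hεq : 1 - ε / q = (1 - η) / (1 + η) := by
    rw [hq]; field_simp; ring
  have hLM : L ≤ M * ε * a1 := by
    by_contra! hcon
    have hm : M * (q / (1 - q)) < Real.log (1 / δ) := by
      refine lt_of_le_of_lt ?_ hcon
      rw [mul_assoc]
      gcongr
      calc q / (1 - q) ≤ q / ((1 - η) / 2) := by gcongr; linarith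
        _ = ε * a1 := by rw [hq, ha1]; field_simp
    obtain ⟨D, hD, hs, hhs, hlt⟩ :=
      hnd.exists_lt_measure_badSamples hH hε0 hqε hq1 hδ0 hm
    have := lt_ermCutoffSampleComplexity D hhs hlt
    rw [← hM] at this
    exact lt_irrefl _ this
  have hkM : ∀ k : ℕ, 0 < k → ((k + 1 : ℕ) : ℕ∞) ≤ graphDim H γ → ((k + 1 : ℕ) : ℝ) ≤ M * ε * a2 := by
    intro k hk hkd
    obtain ⟨S, hS⟩ := exists_graphShattered (Nat.succ_pos k) hkd
    have hk1 : (1 : ℝ) ≤ k := by exact_mod_cast hk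
    by_contra! hcon
    have hm : M * q < (1 - δ) * ((1 - ε / q) * k) := by
      rw [hεq]
      have h1 : M * q = M * ε * a2 * ((1 - η) * ((1 - η) / (1 + η)) / 2) := by
        rw [hq, ha2]; field_simp
      rw [h1]
      calc M * ε * a2 * ((1 - η) * ((1 - η) / (1 + η)) / 2)
          < ((k + 1 : ℕ) : ℝ) * ((1 - η) * ((1 - η) / (1 + η)) / 2) := by gcongr
        _ ≤ (2 * k) * ((1 - η) * ((1 - η) / (1 + η)) / 2) := by
            gcongr; push_cast; linarith
        _ = (1 - η) * ((1 - η) / (1 + η) * k) := by ring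
        _ ≤ _ := by gcongr
    obtain ⟨D, hD, hs, hhs, hlt⟩ :=
      hS.exists_lt_measure_badSamples hH hk hε0 hqε hq1.le hδ0 hm
    have := lt_ermCutoffSampleComplexity D hhs hlt
    rw [← hM] at this
    exact lt_irrefl _ this
  have hMε : 0 ≤ M * ε := by positivity
  have hdM : ∀ d : ℕ, (d : ℕ∞) ≤ graphDim H γ → d + L ≤ M * ε * A := by
    intro d hd
    have h1 : (d : ℝ) ≤ M * ε * a2 + M * ε * (a1 / a) := by
      rcases Nat.lt_or_ge 1 d with h | h
      · obtain ⟨k, rfl⟩ : ∃ k, d = k + 1 := ⟨d - 1, by omega⟩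
        have := hkM k (by omega) hd
        have h0 : 0 ≤ M * ε * (a1 / a) := by positivity
        linarith
      · have h' : (d : ℝ) ≤ 1 := by exact_mod_cast h
        have h2 : 1 ≤ M * ε * (a1 / a) := by
          rw [← mul_div_assoc, le_div_iff₀ ha0]; linarith
        have h0 : 0 ≤ M * ε * a2 := by positivity
        linarith
    rw [hA]
    linarith
  have hfin : graphDim H γ ≠ ⊤ := by
    intro h
    obtain ⟨d, hd⟩ := exists_nat_gt (M * ε * A)
    have := hdM d (by rw [h]; exact le_top)
    linarith
  obtain ⟨d, hd⟩ := ENat.ne_top_iff_exists.1 hfin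
  have h1 := hdM d hd.le
  have h2 : 1 / A * ((d + L) / ε) ≤ M := by
    rw [div_mul_div_comm, one_mul, div_le_iff₀ (by positivity)]; linarith
  calc _ = ENNReal.ofReal (1 / A * ((d + L) / ε)) := by
        rw [ENNReal.ofReal_mul (by positivity), ENNReal.ofReal_div_of_pos hε0,
          ENNReal.ofReal_add (by positivity) (by linarith), ← hd]
        simp
    _ ≤ ENNReal.ofReal M := ENNReal.ofReal_le_ofReal h2
    _ = _ := by rw [← hM]; simp

/-! ### Risk bound at all scales -/

theorem expectedLoss_le_one {X : Type u} [MeasurableSpace X] (D : Measure X)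
    [IsProbabilityMeasure D] (h g : X → unitInterval) : expectedLoss D h g ≤ 1 := by
  calc expectedLoss D h g ≤ ∫⁻ _, 1 ∂D :=
        lintegral_mono fun x => ENNReal.ofReal_le_one.2 (abs_sub_unitInterval_le_one _ _)
    _ = 1 := by simp

/-- The failure probability at one scale is at most `δ / n`, small enough for a union bound over the
dimensions `1, …, n - 1`: the factor `n` costs `log n`, which the term `d log (n + 1)` absorbs. -/
theorem measure_badSamples_le_div {X : Type u} [MeasurableSpace X] {H : Set (X → unitInterval)}
    (hH : ∀ h ∈ H, Measurable h) {γ δ : ℝ} {hs : X → unitInterval} {n d : ℕ} (D : Measure X)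
    [IsProbabilityMeasure D] (hadm : Admissible H γ) (hhs : hs ∈ H) (hd : graphDim H γ ≤ d)
    (hd1 : 1 ≤ d) (hn : 1 ≤ n) (hδ0 : 0 < δ) (hδ1 : δ < 1) :
    Measure.pi (fun _ : Fin n => D)
      (badSamples H D γ (102400 * ((d * Real.log (n + 1) + Real.log (1 / δ)) / n)) hs n)
      ≤ ENNReal.ofReal (δ / n) := by
  set ε := 102400 * ((d * Real.log (n + 1) + Real.log (1 / δ)) / n) with hε
  have hn1 : (1 : ℝ) ≤ n := by exact_mod_cast hn
  have hd1' : (1 : ℝ) ≤ d := by exact_mod_cast hd1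
  set l := Real.log (n + 1) with hl
  have hlog2 : 1 / 2 ≤ Real.log 2 := by have := Real.log_two_gt_d9; linarith
  have hl2 : Real.log 2 ≤ l := Real.log_le_log (by norm_num) (by linarith)
  have hLδ : 0 ≤ Real.log (1 / δ) := Real.log_nonneg (by rw [le_div_iff₀ hδ0]; linarith)
  have hdl : l ≤ d * l := le_mul_of_one_le_left (by linarith) hd1'
  have hεn : ε * n = 102400 * (d * l + Real.log (1 / δ)) := by
    rw [hε]; field_simp
  have hε0 : 0 < ε := by
    have : 0 < d * l + Real.log (1 / δ) := by linarith
    rw [hε]; positivity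
  rcases lt_or_ge 1 ε with h1 | h1
  · have : badSamples H D γ ε hs n = ∅ := by
      ext S
      simp only [badSamples, Set.mem_ofPred_eq, Set.mem_empty_iff_false, iff_false]
      rintro ⟨h, _, _, hlt⟩
      exact absurd (hlt.trans_le prob_le_one) (not_lt.2 (ENNReal.one_le_ofReal.2 h1.le))
    rw [this, measure_empty]
    exact bot_le
  refine measure_badSamples_le hH D hadm hhs hd hd1 hε0 h1 (by positivity)
    (by rw [div_le_one (by linarith)]; linarith) ?_
  have h2 : Real.log (2048 / ε) ≤ 12 * l := by
    have h3 : (2048 / ε) ≤ 2048 * (n + 1) := by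
      rw [div_le_iff₀ hε0]
      have : 1 ≤ ε * n := by rw [hεn]; linarith
      nlinarith
    calc Real.log (2048 / ε) ≤ Real.log (2048 * (n + 1)) :=
          Real.log_le_log (by positivity) h3
      _ = Real.log (2 ^ 11) + l := by
          rw [Real.log_mul (by norm_num) (by positivity), hl]; norm_num
      _ = 11 * Real.log 2 + l := by rw [Real.log_pow]; norm_num
      _ ≤ _ := by linarith
  have h4 : Real.log (1 / (δ / n)) ≤ l + Real.log (1 / δ) := by
    rw [hl, ← Real.log_mul (by positivity) (by positivity)]
    refine Real.log_le_log (by positivity) ?_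
    rw [one_div_div, mul_one_div]
    gcongr
    linarith
  have h5 : 16 * d * Real.log (2048 / ε) ≤ 16 * d * (12 * l) := by gcongr
  rw [hεn]
  linarith

/-- The risk bound for every ERM. Only scales of dimension `1 ≤ d < n` matter: at dimension `0` the
bound holds always, and for `d ≥ n` it exceeds `1`. Among the scales of dimension `d`, the least
scale of dimension at most `d` is the hardest. -/
theorem measure_risk_bound_lt_expectedLoss_le {X : Type u} [MeasurableSpace X]
    {H : Set (X → unitInterval)} (hH : ∀ h ∈ H, Measurable h)
    (hadm : ∀ γ ∈ Icc (0 : ℝ) 1, Admissible H γ) {A : Learner X} (hA : IsERM H A) {n : ℕ}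
    (hn : 1 ≤ n) {δ : ℝ} (hδ : δ ∈ Ioo (0 : ℝ) 1) (D : Measure X) [IsProbabilityMeasure D]
    {hs : X → unitInterval} (hhs : hs ∈ H) :
    Measure.pi (fun _ : Fin n => D)
      {S | (⨅ γ ∈ Icc (0 : ℝ) 1, (ENNReal.ofReal γ + ENNReal.ofReal 102400 *
              (((graphDim H γ : ℝ≥0∞) * ENNReal.ofReal (Real.log (n + 1)) +
                ENNReal.ofReal (Real.log (1 / δ))) / (n : ℝ≥0∞))))
            < expectedLoss D (A n (labeled hs S)) hs}
      ≤ ENNReal.ofReal δ := by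
  obtain ⟨hδ0, hδ1⟩ := hδ
  have hn1 : (1 : ℝ) ≤ n := by exact_mod_cast hn
  have hlog2 : 1 / 2 ≤ Real.log 2 := by have := Real.log_two_gt_d9; linarith
  have hl2 : Real.log 2 ≤ Real.log (n + 1) := Real.log_le_log (by norm_num) (by linarith)
  have hLδ : 0 ≤ Real.log (1 / δ) := Real.log_nonneg (by rw [le_div_iff₀ hδ0]; linarith)
  let e : ℕ → ℝ := fun d => 102400 * ((d * Real.log (n + 1) + Real.log (1 / δ)) / n)
  have he : ∀ d : ℕ, ENNReal.ofReal 102400 * (((d : ℝ≥0∞) * ENNReal.ofReal (Real.log (n + 1)) +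
      ENNReal.ofReal (Real.log (1 / δ))) / (n : ℝ≥0∞)) = ENNReal.ofReal (e d) := by
    intro d
    simp only [e]
    rw [ENNReal.ofReal_mul (by norm_num), ENNReal.ofReal_div_of_pos (by linarith),
      ENNReal.ofReal_add (mul_nonneg (Nat.cast_nonneg d) (by linarith)) hLδ,
      ENNReal.ofReal_mul (p := (d : ℝ)) (Nat.cast_nonneg d), ENNReal.ofReal_natCast,
      ENNReal.ofReal_natCast]
  let F : ℕ → Set (Fin n → X) := fun d => {S | ∃ γ ∈ Icc (0 : ℝ) 1, graphDim H γ = d ∧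
    ENNReal.ofReal γ + ENNReal.ofReal (e d) < expectedLoss D (A n (labeled hs S)) hs}
  have hF : ∀ d, 1 ≤ d → Measure.pi (fun _ : Fin n => D) (F d) ≤ ENNReal.ofReal (δ / n) := by
    intro d hd1
    rcases Set.eq_empty_or_nonempty (F d) with hemp | ⟨S₀, γ₀, hγ₀, hd₀, _⟩
    · rw [hemp, measure_empty]; exact bot_le
    obtain ⟨γ, ⟨hγ, hd⟩, hleast⟩ := exists_isLeast_graphDim_le (H := H) (d := d)
      ⟨γ₀, hγ₀, hd₀.le⟩
    refine (measure_mono ?_).trans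
      (measure_badSamples_le_div hH D (hadm γ hγ) hhs hd hd1 hn hδ0 hδ1)
    rintro S ⟨γ', hγ', hd', hlt⟩
    obtain ⟨hmem, hcons⟩ := hA.mem hhs S
    refine ⟨_, hmem, hcons, ?_⟩
    have h1 : ENNReal.ofReal γ ≤ ENNReal.ofReal γ' :=
      ENNReal.ofReal_le_ofReal (hleast ⟨hγ', hd'.le⟩)
    have h2 : ENNReal.ofReal γ + ENNReal.ofReal (e d) < expectedLoss D (A n (labeled hs S)) hs :=
      lt_of_le_of_lt (by gcongr) hlt
    exact (ENNReal.add_lt_add_iff_left ENNReal.ofReal_ne_top).1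
      (h2.trans_le (expectedLoss_le_add_cutoffLoss D (hH _ hmem) (hH _ hhs) γ))
  have hsub : {S | (⨅ γ ∈ Icc (0 : ℝ) 1, (ENNReal.ofReal γ + ENNReal.ofReal 102400 *
              (((graphDim H γ : ℝ≥0∞) * ENNReal.ofReal (Real.log (n + 1)) +
                ENNReal.ofReal (Real.log (1 / δ))) / (n : ℝ≥0∞))))
            < expectedLoss D (A n (labeled hs S)) hs} ⊆ ⋃ d ∈ Finset.Ico 1 n, F d := by
    intro S hS
    obtain ⟨γ, hS⟩ := iInf_lt_iff.1 (Set.mem_ofPred_eq.mp hS)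
    obtain ⟨hγ, hS⟩ := iInf_lt_iff.1 hS
    have hle1 := expectedLoss_le_one D (A n (labeled hs S)) hs
    have hfin : graphDim H γ ≠ ⊤ := by
      intro htop
      have hl0 : ENNReal.ofReal (Real.log (n + 1)) ≠ 0 :=
        (ENNReal.ofReal_pos.2 (by linarith)).ne'
      have hK0 : ENNReal.ofReal 102400 ≠ 0 := (ENNReal.ofReal_pos.2 (by norm_num)).ne'
      rw [htop, ENat.toENNReal_top, ENNReal.top_mul hl0, top_add,
        ENNReal.top_div_of_ne_top (ENNReal.natCast_ne_top n), ENNReal.mul_top hK0, add_top] at hS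
      exact not_top_lt hS
    obtain ⟨d, hd⟩ := ENat.ne_top_iff_exists.1 hfin
    rw [← hd, ENat.toENNReal_coe, he] at hS
    refine Set.mem_iUnion₂.2 ⟨d, Finset.mem_Ico.2 ⟨?_, ?_⟩, γ, hγ, hd.symm, hS⟩
    · -- at dimension `0` members of `H` are within `γ` of each other
      rw [Nat.one_le_iff_ne_zero]
      rintro rfl
      have h1 := expectedLoss_le_add_cutoffLoss D (hH _ (hA.mem hhs S).1) (hH _ hhs) γ
      rw [cutoffLoss_eq_zero_of_graphDim_eq_zero (by rw [← hd]; rfl) (hA.mem hhs S).1 hhs,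
        add_zero] at h1
      exact absurd (hS.trans_le h1) (not_lt.2 le_self_add)
    · -- for `d ≥ n` the bound exceeds `1`
      by_contra! hdn
      have hdn' : (n : ℝ) ≤ d := by exact_mod_cast hdn
      have h1 : 1 ≤ e d := by
        have h2 : (n : ℝ) * Real.log (n + 1) ≤ d * Real.log (n + 1) :=
          mul_le_mul_of_nonneg_right hdn' (by linarith)
        have h3 : (n : ℝ) * (1 / 2) ≤ n * Real.log (n + 1) := by gcongr; linarith
        have : (1 / 2 : ℝ) ≤ (d * Real.log (n + 1) + Real.log (1 / δ)) / n := by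
          rw [le_div_iff₀ (by linarith)]; linarith
        simp only [e]; linarith
      exact absurd (hS.trans_le hle1)
        (not_lt.2 ((ENNReal.one_le_ofReal.2 h1).trans le_add_self))
  calc _ ≤ Measure.pi (fun _ : Fin n => D) (⋃ d ∈ Finset.Ico 1 n, F d) := measure_mono hsub
    _ ≤ ∑ d ∈ Finset.Ico 1 n, Measure.pi (fun _ : Fin n => D) (F d) :=
        measure_biUnion_finset_le _ _
    _ ≤ ∑ d ∈ Finset.Ico 1 n, ENNReal.ofReal (δ / n) :=
        Finset.sum_le_sum fun d hd => hF d (Finset.mem_Ico.1 hd).1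
    _ ≤ n * ENNReal.ofReal (δ / n) := by
        rw [Finset.sum_const, nsmul_eq_mul, Nat.card_Ico]
        gcongr
        exact_mod_cast Nat.sub_le n 1
    _ = ENNReal.ofReal δ := by
        rw [← ENNReal.ofReal_natCast, ← ENNReal.ofReal_mul (by positivity)]
        congr 1; field_simp

/-! ### Learnability by every ERM -/

theorem ermSampleComplexity_lt_top {X : Type u} [MeasurableSpace X] {H : Set (X → unitInterval)}
    (hH : ∀ h ∈ H, Measurable h) (hadm : ∀ γ ∈ Ioo (0 : ℝ) 1, Admissible H γ)
    (hdim : ∀ γ ∈ Ioo (0 : ℝ) 1, graphDim H γ < ⊤) {ε δ : ℝ} (hε : ε ∈ Ioo (0 : ℝ) 1)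
    (hδ : δ ∈ Ioo (0 : ℝ) 1) : ermSampleComplexity H ε δ < ⊤ := by
  have hγ : ε / 2 ∈ Ioo (0 : ℝ) 1 := ⟨by linarith [hε.1], by linarith [hε.1, hε.2]⟩
  obtain ⟨C, _, hC⟩ := exists_ermCutoffSampleComplexity_le.{u} (η := max (ε / 2) δ)
    ⟨lt_max_of_lt_left hγ.1, max_lt hγ.2 hδ.2⟩
  have h1 := hC X H hH (ε / 2) (ε / 2) ⟨hγ.1, le_max_left _ _⟩ δ ⟨hδ.1, le_max_right _ _⟩
    (hadm _ hγ)
  have h2 := ermSampleComplexity_le_cutoff hH (ε := ε / 2) (δ := δ) hγ.1.le hγ.1.le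
  rw [add_halves] at h2
  refine h2.trans_lt (ENat.toENNReal_lt.1 (h1.trans_lt ?_))
  have h3 : (graphDim H (ε / 2) : ℝ≥0∞) ≠ ⊤ := by
    simpa using (hdim _ hγ).ne
  have h4 : ENNReal.ofReal (ε / 2) ≠ 0 := (ENNReal.ofReal_pos.2 hγ.1).ne'
  rw [ENat.toENNReal_top]
  exact ENNReal.mul_lt_top ENNReal.ofReal_lt_top (ENNReal.div_lt_top
    (ENNReal.add_ne_top.2 ⟨ENNReal.mul_ne_top h3 ENNReal.ofReal_ne_top, ENNReal.ofReal_ne_top⟩) h4)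

theorem IsERM.isPACLearner {X : Type u} [MeasurableSpace X] {H : Set (X → unitInterval)}
    {A : Learner X} (hA : IsERM H A)
    (hfin : ∀ ε ∈ Ioo (0 : ℝ) 1, ∀ δ ∈ Ioo (0 : ℝ) 1, ermSampleComplexity H ε δ < ⊤) :
    IsPACLearner H A := by
  intro ε hε δ hδ
  have h : sampleComplexity H A ε δ < ⊤ :=
    (le_iSup₂ (f := fun (A : Learner X) (_ : IsERM H A) => sampleComplexity H A ε δ) A hA).trans_lt
      (hfin ε hε δ hδ)
  obtain ⟨M, h⟩ := iInf_lt_iff.1 h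
  obtain ⟨hM, _⟩ := iInf_lt_iff.1 h
  exact ⟨M, hM M le_rfl⟩

/-- If the dimension at some scale is infinite, one ERM fails at all sample sizes with the same
accuracy and confidence. -/
theorem graphDim_lt_top_of_forall_isPACLearner {X : Type u} [MeasurableSpace X]
    {H : Set (X → unitInterval)} (hH : ∀ h ∈ H, Measurable h)
    (hpac : ∀ A : Learner X, IsERM H A → IsPACLearner H A) {γ : ℝ} (hγ : γ ∈ Ioo (0 : ℝ) 1) :
    graphDim H γ < ⊤ := by
  by_contra hcon
  have htop : graphDim H γ = ⊤ := not_lt_top_iff.1 hcon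
  have hbad : ∀ n : ℕ, ∃ D : Measure X, IsProbabilityMeasure D ∧ ∃ hs ∈ H,
      ENNReal.ofReal (1 / 2) <
        Measure.pi (fun _ : Fin n => D) (badSamples H D γ (1 / 4) hs n) := by
    intro n
    obtain ⟨S, hS⟩ := exists_graphShattered (H := H) (γ := γ) (d := (2 * n + 1) + 1)
      (Nat.succ_pos _) (by rw [htop]; exact le_top)
    refine hS.exists_lt_measure_badSamples hH (q := 1 / 2) (by omega) (by norm_num) (by norm_num)
      (by norm_num) (by norm_num) ?_
    push_cast
    linarith
  choose D hD hs hhs hlt using hbad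
  obtain ⟨A, hA, hAbad⟩ := exists_erm_forall_badSamples γ (1 / 4) D hs hhs
  obtain ⟨n, hn⟩ := hpac A hA (γ * (1 / 4)) ⟨by linarith [hγ.1], by linarith [hγ.2]⟩ (1 / 2)
    ⟨by norm_num, by norm_num⟩
  have := hD n
  exact absurd (hn.cutoffPACGuarantee hH hA hγ.1 (D n) (hs n) (hhs n))
    (not_le.2 ((hlt n).trans_le (measure_mono fun S hS => hAbad n S hS)))

theorem mainTheorem1 :
    -- sample complexity of the worst-case ERM: lower and upper bound
    (∀ η ∈ Ioo (0 : ℝ) 1, ∃ c C : ℝ, 0 < c ∧ 0 < C ∧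
      ∀ (X : Type u) [MeasurableSpace X] (H : Set (X → unitInterval)),
        (∀ h ∈ H, Measurable h) →
        ∀ γ ∈ Ioo (0 : ℝ) 1, ∀ ε ∈ Ioc (0 : ℝ) η, ∀ δ ∈ Ioc (0 : ℝ) η,
          (Nondegenerate H γ →
            ENNReal.ofReal c *
                (((graphDim H γ : ℝ≥0∞) + ENNReal.ofReal (Real.log (1 / δ))) / ENNReal.ofReal ε)
              ≤ (ermCutoffSampleComplexity H ε δ γ : ℝ≥0∞) ∧
            ENNReal.ofReal c *
                (((graphDim H γ : ℝ≥0∞) + ENNReal.ofReal (Real.log (1 / δ))) / ENNReal.ofReal ε)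
              ≤ (ermSampleComplexity H (γ * ε) δ : ℝ≥0∞)) ∧
          (Admissible H γ →
            (ermCutoffSampleComplexity H ε δ γ : ℝ≥0∞) ≤
              ENNReal.ofReal C *
                (((graphDim H γ : ℝ≥0∞) * ENNReal.ofReal (Real.log (1 / ε)) +
                  ENNReal.ofReal (Real.log (1 / δ))) / ENNReal.ofReal ε) ∧
            (ermSampleComplexity H (γ + ε) δ : ℝ≥0∞) ≤
              ENNReal.ofReal C *
                (((graphDim H γ : ℝ≥0∞) * ENNReal.ofReal (Real.log (1 / ε)) +
                  ENNReal.ofReal (Real.log (1 / δ))) / ENNReal.ofReal ε))) ∧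
    -- risk bound for every ERM
    (∃ K : ℝ, 0 < K ∧
      ∀ (X : Type u) [MeasurableSpace X] (H : Set (X → unitInterval)),
        (∀ h ∈ H, Measurable h) → (∀ γ ∈ Icc (0 : ℝ) 1, Admissible H γ) →
        ∀ A : Learner X, IsERM H A →
        ∀ n : ℕ, 1 ≤ n → ∀ δ ∈ Ioo (0 : ℝ) 1,
        ∀ (D : Measure X) [IsProbabilityMeasure D], ∀ hs ∈ H,
          Measure.pi (fun _ : Fin n => D)
            {S | (⨅ γ ∈ Icc (0 : ℝ) 1, (ENNReal.ofReal γ + ENNReal.ofReal K *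
                    (((graphDim H γ : ℝ≥0∞) * ENNReal.ofReal (Real.log (n + 1)) +
                      ENNReal.ofReal (Real.log (1 / δ))) / (n : ℝ≥0∞))))
                  < expectedLoss D (A n (labeled hs S)) hs}
            ≤ ENNReal.ofReal δ) ∧
    -- qualitative characterization of learnability by every ERM
    (∀ (X : Type u) [MeasurableSpace X] (H : Set (X → unitInterval)),
      (∀ h ∈ H, Measurable h) → (∀ γ ∈ Ioo (0 : ℝ) 1, Admissible H γ) →
      ((∀ A : Learner X, IsERM H A → IsPACLearner H A) ↔
        ∀ γ ∈ Ioo (0 : ℝ) 1, graphDim H γ < ⊤) ∧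
      ((∀ ε ∈ Ioo (0 : ℝ) 1, ∀ δ ∈ Ioo (0 : ℝ) 1, ermSampleComplexity H ε δ < ⊤) ↔
        ∀ γ ∈ Ioo (0 : ℝ) 1, graphDim H γ < ⊤)) := by
  refine ⟨fun η hη => ?_, ⟨102400, by norm_num, ?_⟩, ?_⟩
  · obtain ⟨c, hc, hlow⟩ := exists_le_ermCutoffSampleComplexity.{u} hη
    obtain ⟨C, hC, hup⟩ := exists_ermCutoffSampleComplexity_le.{u} hη
    refine ⟨c, C, hc, hC, fun X _ H hH γ hγ ε hε δ hδ => ⟨fun hnd => ?_, fun hadm => ?_⟩⟩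
    · have h := hlow X H hH γ ε hε δ hδ hnd
      exact ⟨h, h.trans (ENat.toENNReal_le.2 (ermCutoffSampleComplexity_le hH hγ.1))⟩
    · have h := hup X H hH γ ε hε δ hδ hadm
      exact ⟨h, (ENat.toENNReal_le.2 (ermSampleComplexity_le_cutoff hH hγ.1.le hε.1.le)).trans h⟩
  · intro X _ H hH hadm A hA n hn δ hδ D _ hs hhs
    exact measure_risk_bound_lt_expectedLoss_le hH hadm hA hn hδ D hhs
  · intro X _ H hH hadm
    refine ⟨⟨fun hpac γ hγ => graphDim_lt_top_of_forall_isPACLearner hH hpac hγ,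
      fun hdim A hA => hA.isPACLearner fun ε hε δ hδ =>
        ermSampleComplexity_lt_top hH hadm hdim hε hδ⟩,
      fun hfin γ hγ => graphDim_lt_top_of_forall_isPACLearner hH
        (fun A hA => hA.isPACLearner hfin) hγ,
      fun hdim ε hε δ hδ => ermSampleComplexity_lt_top hH hadm hdim hε hδ⟩
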